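/- Let $n\ge 1$ be an integer, $\delta>0$, $\mu\in\mathbb{R}$ and $\beta\in\mathbb{R}$ with $\beta\le n+2$. Put $$a=\frac{n+2-\beta}{2},\qquad b=\frac{n+2}{2},\qquad z=z(\nu)=\frac{\delta\|\nu\|}{2}\quad(\nu\in\mathbb{R}^n),$$ where $\|\cdot\|$ is the Euclidean norm, and $$\lambda_{1,1}(\nu)=-3\mu\|\nu\|^2\,{}_3F_4\!\left(1,\tfrac52,a;\,2,\tfrac32,b+1,a+1;\,-z^2\right),$$ where ${}_pF_q(a_1,\dots,a_p;b_1,\dots,b_q;x)=\sum_{k\ge0}\frac{(a_1)_k\cdots(a_p)_k}{(b_1)_k\cdots(b_q)_k}\frac{x^k}{k!}$ and $(c)_k=c(c+1)\cdots(c+k-1)$. Let $\gamma$ be Euler's constant and $\psi=\Gamma'/\Gamma$ the digamma function, and read $1/\Gamma$ as $0$ at the poles of $\Gamma$. Define $$A(\nu)=\begin{cases} -\dfrac{4\mu ab}{\delta^2(a-1)}-\dfrac{n-\beta-1}{n-\beta}\,\dfrac{\Gamma(b+1)\Gamma(a+1)}{\Gamma\left(\frac{\beta+2}{2}\right)}\,\dfrac{8\mu}{\delta^2}\,z^{\beta-n}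 & \text{if }\beta\ne n,\\[2ex] -\dfrac{4\mu ab}{\delta^2}\left(2\log z+\gamma+2-\psi(b)\right) & \text{if }\beta=n. \end{cases}$$ Then, as $\|\nu\|\to\infty$, $$\lambda_{1,1}(\nu)\sim A(\nu),\qquad\text{and moreover}\qquad \lambda_{1,1}(\nu)=A(\nu)+O\!\left(\|\nu\|^{-\frac{n+1}{2}}\right),$$ where $f\sim g$ means $f-g=o(g)$ and the implied constant may depend on $n,\delta,\beta,\mu$. -/

import Mathlib

open Filter Asymptotics Bornology

namespace Peridynamics

noncomputable section

/-- The `k`-th term of the generalized hypergeometric series `pFq(as; bs; x)`; the rising factorial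
`(c)_k = c (c + 1) ⋯ (c + k - 1)` is `(ascPochhammer ℝ k).eval c`. -/
def hypergeometricTerm (as bs : List ℝ) (x : ℝ) (k : ℕ) : ℝ :=
  (as.map fun c => (ascPochhammer ℝ k).eval c).prod /
    (bs.map fun c => (ascPochhammer ℝ k).eval c).prod * (x ^ k / (k.factorial : ℝ))

/-- The generalized hypergeometric function `pFq(as; bs; x)`, as the sum of its series. -/
def hypergeometric (as bs : List ℝ) (x : ℝ) : ℝ :=
  ∑' k : ℕ, hypergeometricTerm as bs x k

/-- `a = (n + 2 - β) / 2`. -/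
def paramA (n : ℕ) (β : ℝ) : ℝ := ((n : ℝ) + 2 - β) / 2

/-- `b = (n + 2) / 2`. -/
def paramB (n : ℕ) : ℝ := ((n : ℝ) + 2) / 2

/-- `z(ν) = δ ‖ν‖ / 2`, with the Euclidean norm of `ν ∈ ℝⁿ`. -/
def paramZ {n : ℕ} (δ : ℝ) (ν : EuclideanSpace ℝ (Fin n)) : ℝ := δ * ‖ν‖ / 2

/-- `λ₁,₁(ν) = -3 μ ‖ν‖² ₃F₄(1, 5/2, a; 2, 3/2, b + 1, a + 1; -z²)`. -/
def lambda11 {n : ℕ} (δ β μ : ℝ) (ν : EuclideanSpace ℝ (Fin n)) : ℝ :=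
  -3 * μ * ‖ν‖ ^ 2 *
    hypergeometric [1, 5 / 2, paramA n β] [2, 3 / 2, paramB n + 1, paramA n β + 1]
      (-(paramZ δ ν) ^ 2)

/-- The digamma function `ψ = Γ'/Γ` at a real argument. -/
def digamma (x : ℝ) : ℝ := (Complex.digamma (x : ℂ)).re

/-- Rising factorials are nonnegative and monotone on nonnegative arguments. -/
theorem rising_mono (k : ℕ) {s t : ℝ} (hs : 0 ≤ s) (hst : s ≤ t) :
    0 ≤ (ascPochhammer ℝ k).eval s ∧
      (ascPochhammer ℝ k).eval s ≤ (ascPochhammer ℝ k).eval t := by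
  induction k with
  | zero => simp
  | succ k ih =>
    rw [ascPochhammer_succ_eval, ascPochhammer_succ_eval]
    have hk : (0 : ℝ) ≤ k := Nat.cast_nonneg k
    exact ⟨mul_nonneg ih.1 (by linarith),
      mul_le_mul ih.2 (by linarith) (by linarith) (ih.1.trans ih.2)⟩

/-- The hypergeometric series in the definition of `lambda11` converges, so that its sum is not a
default value. -/
theorem summable_lambda11_series (n : ℕ) (hn : 1 ≤ n) (β : ℝ) (hβ : β ≤ n + 2) (x : ℝ) :
    Summable (hypergeometricTerm [1, 5 / 2, paramA n β]
      [2, 3 / 2, paramB n + 1, paramA n β + 1] x) := by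
  have hn' : (1 : ℝ) ≤ n := by exact_mod_cast hn
  have ha : 0 ≤ paramA n β := by unfold paramA; linarith
  have hb : 5 / 2 ≤ paramB n + 1 := by unfold paramB; linarith
  refine Summable.of_norm_bounded (Real.summable_pow_div_factorial |x|) fun k => ?_
  unfold hypergeometricTerm
  simp only [List.map_cons, List.map_nil, List.prod_cons, List.prod_nil, mul_one]
  obtain ⟨h0, h1⟩ := rising_mono k (s := 1) (t := 3 / 2) (by norm_num) (by norm_num)
  obtain ⟨h2, h3⟩ := rising_mono k (s := 5 / 2) (t := paramB n + 1) (by norm_num) hb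
  obtain ⟨h4, h5⟩ := rising_mono k ha (t := paramA n β + 1) (by linarith)
  have h6 : 1 ≤ (ascPochhammer ℝ k).eval (2 : ℝ) := by
    have := (rising_mono k (s := 1) (t := 2) (by norm_num) (by norm_num)).2
    rw [ascPochhammer_eval_one] at this
    exact le_trans (by exact_mod_cast Nat.succ_le_of_lt k.factorial_pos) this
  have key : ∀ p q r t u v w : ℝ, 0 ≤ p → p ≤ u → 0 ≤ q → q ≤ v → 0 ≤ r → r ≤ w → 1 ≤ t →
      |p * (q * r) / (t * (u * (v * w)))| ≤ 1 := by
    intro p q r t u v w hp hpu hq hqv hr hrw ht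
    have hP : 0 ≤ p * (q * r) := by positivity
    have hQ : p * (q * r) ≤ u * (v * w) :=
      mul_le_mul hpu (mul_le_mul hqv hrw hr (hq.trans hqv)) (by positivity) (hp.trans hpu)
    have hR : u * (v * w) ≤ t * (u * (v * w)) := le_mul_of_one_le_left (hP.trans hQ) ht
    rw [abs_of_nonneg (div_nonneg hP (hP.trans (hQ.trans hR)))]
    exact div_le_one_of_le₀ (hQ.trans hR) (hP.trans (hQ.trans hR))
  rw [Real.norm_eq_abs, abs_mul, abs_div (x ^ k), abs_pow, Nat.abs_cast]
  exact mul_le_of_le_one_left (by positivity) (key _ _ _ _ _ _ _ h0 h1 h2 h3 h4 h5 h6)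

end

end Peridynamics

namespace Peridynamics

noncomputable section

open Set MeasureTheory Topology

/-! Parameters of the ₃F₄ pair off with shift one, so its `k`-th term is `a / 3 * (2k + 3) / ((1 +
k)(a + k))` times the term `t_k` of `₀F₁(B; -x)`, where `B = b + 1` and `x = z²`. Partial fractions
leave the sums `∑ t_k / (c + k)` with `c = 1` and `c = a`; at `a = 1`, i.e. `β = n`, the double pole
brings in `∑ t_k / (1 + k)²`, the source of the logarithm. At `a = 0` the series reduces to 1.

Since `∑ t_k / (c + k) = ∫₀¹ s^(c-1) ₀F₁(B; -xs) ds`, one extends the integral to `(0, ∞)`. By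
scaling, the full integral is `x^(-c)` times the Mellin transform `Γ(c)Γ(B)/Γ(B-c)`, and the tail
over `(1, ∞)` is controlled by the Bessel decay `x^(-(B/2-1/4))`, which an energy argument on the
differential equation provides (`isBigO_of_bessel_equation`). Differentiating the Mellin transform
at `c = 1` handles the squared denominators.

Absolute convergence requires `B` large compared with `c`. The contiguous relations between `B` and
`B + 1` remove this restriction, and also improve the error to `x^(-(B/2+1/4))`; after
multiplication by `‖ν‖²` this is the exponent `-(n+1)/2`. Equivalence follows because, for `μ ≠ 0`,
`A` stays away from zero while the error tends to zero. -/

/-! ### The function ₀F₁(B; -x): derivative and contiguous relations -/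

/-- The `k`-th term of the series `₀F₁(B; -x)`. -/
def besselTerm (B x : ℝ) (k : ℕ) : ℝ :=
  (-x) ^ k / ((ascPochhammer ℝ k).eval B * (k.factorial : ℝ))

/-- The function `₀F₁(B; -x)`, a normalised Bessel function of `2 √x`. -/
def bessel (B x : ℝ) : ℝ := ∑' k, besselTerm B x k

theorem eval_ascPochhammer_succ_left (B : ℝ) (k : ℕ) :
    (ascPochhammer ℝ (k + 1)).eval B = B * (ascPochhammer ℝ k).eval (B + 1) := by
  rw [ascPochhammer_succ_left]
  simp [Polynomial.eval_comp]

theorem one_le_eval_ascPochhammer {B : ℝ} (hB : 1 ≤ B) (k : ℕ) :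
    1 ≤ (ascPochhammer ℝ k).eval B := by
  have h := (rising_mono k zero_le_one hB).2
  rw [ascPochhammer_eval_one] at h
  exact le_trans (by exact_mod_cast Nat.succ_le_of_lt k.factorial_pos) h

/-- `1 / (B)_k = (B + k) / (B (B + 1)_k)`. -/
theorem inv_eval_ascPochhammer {B : ℝ} (hB : 0 < B) (k : ℕ) :
    ((ascPochhammer ℝ k).eval B)⁻¹ = (B + k) / (B * (ascPochhammer ℝ k).eval (B + 1)) := by
  have h1 := ascPochhammer_pos k (B + 1) (by linarith)
  have h2 := ascPochhammer_succ_eval (S := ℝ) k B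
  rw [eval_ascPochhammer_succ_left] at h2
  rw [h2]
  have : 0 < B + k := by positivity
  field_simp

theorem abs_besselTerm_le {B : ℝ} (hB : 1 ≤ B) (x : ℝ) (k : ℕ) :
    |besselTerm B x k| ≤ |x| ^ k / (k.factorial : ℝ) := by
  have h0 := one_le_eval_ascPochhammer hB k
  have h1 : (0 : ℝ) < k.factorial := by exact_mod_cast k.factorial_pos
  rw [besselTerm, abs_div, abs_pow, abs_neg,
    abs_of_pos (a := _ * _) (mul_pos (by linarith) h1)]
  refine div_le_div_of_nonneg_left (by positivity) h1 ?_
  exact le_mul_of_one_le_left h1.le h0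

theorem summable_mul_besselTerm {B : ℝ} (hB : 1 ≤ B) (x : ℝ) {w : ℕ → ℝ} {M : ℝ}
    (hw : ∀ k, |w k| ≤ M) : Summable fun k => w k * besselTerm B x k := by
  refine Summable.of_norm_bounded ((Real.summable_pow_div_factorial |x|).mul_left M) fun k => ?_
  rw [Real.norm_eq_abs, abs_mul]
  exact mul_le_mul (hw k) (abs_besselTerm_le hB x k) (abs_nonneg _) ((abs_nonneg _).trans (hw k))

theorem summable_besselTerm {B : ℝ} (hB : 1 ≤ B) (x : ℝ) : Summable (besselTerm B x) := by
  simpa using summable_mul_besselTerm hB x (w := fun _ => 1) (M := 1) (by simp)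

theorem besselTerm_succ {B : ℝ} (x : ℝ) (k : ℕ) :
    (k + 1) * besselTerm B x (k + 1) = -x / B * besselTerm (B + 1) x k := by
  rw [besselTerm, besselTerm, eval_ascPochhammer_succ_left, Nat.factorial_succ, pow_succ]
  have : (k : ℝ) + 1 ≠ 0 := by positivity
  push_cast
  field_simp

theorem hasDerivAt_besselTerm_succ (B x : ℝ) (k : ℕ) :
    HasDerivAt (fun y => besselTerm B y (k + 1)) (-(1 / B) * besselTerm (B + 1) x k) x := by
  have h := ((((hasDerivAt_id x).neg).pow (k + 1)).div_const
    ((ascPochhammer ℝ (k + 1)).eval B * ((k + 1).factorial : ℝ)))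
  refine h.congr_deriv ?_
  rw [besselTerm, eval_ascPochhammer_succ_left, Nat.factorial_succ]
  have : (k : ℝ) + 1 ≠ 0 := by positivity
  simp only [id, Nat.add_sub_cancel, Pi.neg_apply]
  push_cast
  field_simp

theorem bessel_eq_one_add {B : ℝ} (hB : 1 ≤ B) (x : ℝ) :
    bessel B x = 1 + ∑' k, besselTerm B x (k + 1) := by
  rw [bessel, (summable_besselTerm hB x).tsum_eq_zero_add]
  simp [besselTerm]

theorem hasDerivAt_bessel {B : ℝ} (hB : 1 ≤ B) (x : ℝ) :
    HasDerivAt (bessel B) (-(1 / B) * bessel (B + 1) x) x := by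
  have hfun : bessel B = fun y => 1 + ∑' k, besselTerm B y (k + 1) :=
    funext (bessel_eq_one_add hB)
  rw [hfun, bessel, ← tsum_mul_left]
  refine HasDerivAt.const_add 1 ?_
  set R := |x| + 1
  have hx : x ∈ Metric.ball (0 : ℝ) R := by simp [R]
  refine hasDerivAt_tsum_of_isPreconnected
    (u := fun k => R ^ k / (k.factorial : ℝ)) (t := Metric.ball 0 R)
    (g' := fun k y => -(1 / B) * besselTerm (B + 1) y k)
    (Real.summable_pow_div_factorial R) Metric.isOpen_ball
    (convex_ball _ _).isPreconnected (fun k y _ => hasDerivAt_besselTerm_succ B y k)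
    (fun k y hy => ?_) hx ?_ hx
  · have hy' : |y| ≤ R := by simpa using (mem_ball_zero_iff.1 hy).le
    rw [norm_mul, norm_neg, Real.norm_of_nonneg (by positivity)]
    refine (mul_le_of_le_one_left (norm_nonneg _) ?_).trans
      ((abs_besselTerm_le (by linarith) y k).trans (by gcongr))
    rw [div_le_one (by linarith)]; exact hB
  · exact (summable_nat_add_iff 1).2 (summable_besselTerm hB x)

theorem continuous_bessel {B : ℝ} (hB : 1 ≤ B) : Continuous (bessel B) :=
  continuous_iff_continuousAt.2 fun x => (hasDerivAt_bessel hB x).continuousAt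

theorem besselTerm_contiguous {B : ℝ} (hB : 1 ≤ B) (x : ℝ) (k : ℕ) :
    besselTerm B x k = (B + k) / B * besselTerm (B + 1) x k := by
  have h := inv_eval_ascPochhammer (zero_lt_one.trans_le hB) k
  have h1 := one_le_eval_ascPochhammer (B := B + 1) (by linarith) k
  rw [besselTerm, besselTerm, div_eq_mul_inv, mul_inv, h]
  have : (0 : ℝ) < k.factorial := by exact_mod_cast k.factorial_pos
  field_simp

/-- Together with `hasDerivAt_bessel`, this is the equation `x f'' + B f' + f = 0` in disguise.
Termwise it comes from `(B + k) / B = 1 + k / B`, where the factor `k` shifts the index. -/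
theorem bessel_contiguous {B : ℝ} (hB : 1 ≤ B) (x : ℝ) :
    bessel B x = bessel (B + 1) x - x / (B * (B + 1)) * bessel (B + 2) x := by
  have hB1 : 1 ≤ B + 1 := by linarith
  have hB2 : 1 ≤ B + 2 := by linarith
  have e : ∀ k, besselTerm B x (k + 1)
      = besselTerm (B + 1) x (k + 1) + -x / (B * (B + 1)) * besselTerm (B + 2) x k := by
    intro k
    rw [besselTerm_contiguous hB x (k + 1)]
    have h := besselTerm_succ (B := B + 1) x k
    rw [add_assoc, one_add_one_eq_two] at h
    have h' : -x / (B * (B + 1)) * besselTerm (B + 2) x k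
        = (k + 1) / B * besselTerm (B + 1) x (k + 1) := by
      rw [show -x / (B * (B + 1)) * besselTerm (B + 2) x k
        = (-x / (B + 1) * besselTerm (B + 2) x k) / B by field_simp, ← h]
      ring
    rw [h']
    push_cast
    field_simp
  rw [bessel_eq_one_add hB, bessel_eq_one_add hB1, tsum_congr e,
    Summable.tsum_add ((summable_nat_add_iff 1).2 (summable_besselTerm hB1 x))
      ((summable_besselTerm hB2 x).mul_left _), tsum_mul_left, bessel.eq_1 (B + 2)]
  ring

/-! ### Decay at infinity by an energy estimate -/

/-- Solutions of `x f'' + B f' + f = 0` decay like `x ^ (-(B / 2 - 1 / 4))`. -/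
theorem isBigO_of_bessel_equation {B : ℝ} (hB : 1 ≤ B) {f g g' : ℝ → ℝ}
    (hf : ∀ x, HasDerivAt f (g x) x) (hg : ∀ x, HasDerivAt g (g' x) x)
    (hode : ∀ x, x * g' x = -B * g x - f x) :
    f =O[atTop] fun x => x ^ (-(B / 2 - 1 / 4)) := by
  set p := B - 1 / 2 with hp
  have hp0 : 0 < p := by simp only [hp]; linarith
  set E : ℝ → ℝ := fun x => f x ^ 2 + x * g x ^ 2 with hE
  -- The derivative of `x ^ p * E` is `p * x ^ (p - 1) * (f² - x g²)`, which has no sign. The cross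
  -- term cancels it exactly, leaving only a multiple of `x ^ (p - 1) * f * g`.
  set V : ℝ → ℝ := fun x => E x + p * (f x * g x) with hV
  set W : ℝ → ℝ := fun x => x ^ p * V x with hW
  -- From `X` on, `|W'| ≤ (p / 2) x^(-3/2) W`, which is integrable at infinity. The exponential
  -- factor has logarithmic derivative `-p x^(-3/2)` and so makes the product decreasing.
  set Φ : ℝ → ℝ := fun x => W x * Real.exp (2 * p * x ^ (-(1 / 2) : ℝ)) with hΦ
  -- Beyond this point `p ≤ √x`, so the cross term costs at most half of `E`.
  set X : ℝ := p ^ 2 + 1 with hX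
  have hX0 : 0 < X := by positivity
  have hfg : ∀ x, 0 < x → √x * (2 * |f x * g x|) ≤ E x := by
    intro x hx
    have h1 := Real.sq_sqrt hx.le
    rw [abs_mul]
    have h2 := sq_nonneg (|f x| - √x * |g x|)
    have h3 := sq_abs (f x)
    have h4 := sq_abs (g x)
    simp only [hE]
    nlinarith
  have hE0 : ∀ x, 0 < x → 0 ≤ E x := fun x hx => by simp only [hE]; positivity
  have hVE : ∀ x, X ≤ x → E x ≤ 2 * V x := by
    intro x hx
    have hx0 : 0 < x := hX0.trans_le hx
    have h1 := hfg x hx0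
    have h2 : p ≤ √x := Real.le_sqrt_of_sq_le (by linarith)
    have h3 : p * (2 * |f x * g x|) ≤ √x * (2 * |f x * g x|) := by gcongr
    have h4 := neg_abs_le (f x * g x)
    simp only [hV]
    nlinarith
  have hWd : ∀ x, 0 < x → HasDerivAt W (-(1 / 2) * p * x ^ (p - 1) * (f x * g x)) x := by
    intro x hx
    have h1 := (Real.hasDerivAt_rpow_const (x := x) (p := p) (Or.inl hx.ne'))
    have h2 := (((hf x).pow 2).add ((hasDerivAt_id x).mul ((hg x).pow 2))).add
      (((hf x).mul (hg x)).const_mul p)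
    refine (h1.mul h2).congr_deriv ?_
    have h3 : x ^ p = x ^ (p - 1) * x := by
      rw [← Real.rpow_add_one hx.ne']; ring_nf
    simp only [h3, id, Pi.pow_apply, Pi.mul_apply, Pi.add_apply, Nat.cast_ofNat]
    have h4 := hode x
    have h5 : B = p + 1 / 2 := by simp [hp]
    rw [h5] at h4
    have h6 : x * g' x = -(p + 1/2) * g x - f x := h4
    linear_combination x ^ (p - 1) * (2 * x * g x + p * f x) * h6
  have hΦd : ∀ x, X ≤ x → ∃ d, HasDerivAt Φ d x ∧ d ≤ 0 := by
    intro x hx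
    have hx0 : 0 < x := hX0.trans_le hx
    have h1 := ((Real.hasDerivAt_rpow_const (x := x) (p := (-(1 / 2) : ℝ))
      (Or.inl hx0.ne')).const_mul (2 * p)).exp
    refine ⟨_, (hWd x hx0).mul h1, ?_⟩
    have e1 : x ^ (-(1 / 2) - 1 : ℝ) = x⁻¹ * (√x)⁻¹ := by
      rw [Real.rpow_sub_one hx0.ne', Real.rpow_neg hx0.le, Real.sqrt_eq_rpow]
      ring
    have e2 : x ^ (p - 1) = x ^ p * x⁻¹ := by rw [Real.rpow_sub_one hx0.ne']; rfl
    have hs : 0 < √x := Real.sqrt_pos.2 hx0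
    have h2 := hfg x hx0
    have h3 := hVE x hx
    have h4 : |f x * g x| ≤ V x * (√x)⁻¹ := by
      rw [← div_eq_mul_inv, le_div_iff₀ hs]; nlinarith
    have h5 := neg_abs_le (f x * g x)
    have h6 : 0 ≤ V x := by linarith [hE0 x hx0]
    have h7 : 0 ≤ V x * (√x)⁻¹ := by positivity
    rw [e1, e2]
    simp only [hW]
    have : -(1 / 2) * p * (x ^ p * x⁻¹) * (f x * g x) *
          Real.exp (2 * p * x ^ (-(1 / 2) : ℝ)) + x ^ p * V x *
          (Real.exp (2 * p * x ^ (-(1 / 2) : ℝ)) * (2 * p * (-(1 / 2) * (x⁻¹ * (√x)⁻¹))))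
        = -(p * x ^ p * x⁻¹ * Real.exp (2 * p * x ^ (-(1 / 2) : ℝ)) *
          ((1 / 2) * (f x * g x) + V x * (√x)⁻¹)) := by ring
    rw [this, neg_nonpos]
    have : 0 ≤ (1 / 2) * (f x * g x) + V x * (√x)⁻¹ := by linarith
    positivity
  have hanti : AntitoneOn Φ (Ici X) := by
    refine antitoneOn_of_deriv_nonpos (convex_Ici X) ?_ ?_ ?_
    · intro x hx
      obtain ⟨d, hd, -⟩ := hΦd x hx
      exact hd.continuousAt.continuousWithinAt
    · intro x hx
      rw [interior_Ici] at hx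
      obtain ⟨d, hd, -⟩ := hΦd x hx.le
      exact hd.differentiableAt.differentiableWithinAt
    · intro x hx
      rw [interior_Ici] at hx
      obtain ⟨d, hd, hd'⟩ := hΦd x hx.le
      rw [hd.deriv]; exact hd'
  have hsq : (fun x => f x ^ 2) =O[atTop] fun x => (x ^ (-(B / 2 - 1 / 4))) ^ 2 := by
    refine IsBigO.of_bound (2 * Φ X) ?_
    filter_upwards [eventually_ge_atTop X] with x hx
    have hx0 : 0 < x := hX0.trans_le hx
    have h1 : Φ x ≤ Φ X := hanti self_mem_Ici hx hx
    have h2 : f x ^ 2 ≤ 2 * V x := by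
      refine le_trans ?_ (hVE x hx)
      simp only [hE]
      have : 0 ≤ x * g x ^ 2 := by positivity
      linarith
    have h3 : 0 ≤ V x := by nlinarith [sq_nonneg (f x)]
    have h4 : W x ≤ Φ x := by
      refine le_mul_of_one_le_right (by simp only [hW]; positivity) (Real.one_le_exp (by positivity))
    have e : (x ^ (-(B / 2 - 1 / 4))) ^ 2 = (x ^ p)⁻¹ := by
      rw [← Real.rpow_natCast, ← Real.rpow_mul hx0.le, ← Real.rpow_neg hx0.le]
      congr 1; simp only [hp]; push_cast; ring
    rw [e, Real.norm_of_nonneg (sq_nonneg _), Real.norm_of_nonneg (by positivity),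
      ← div_eq_mul_inv, le_div_iff₀ (by positivity)]
    have h5 : f x ^ 2 * x ^ p ≤ 2 * V x * x ^ p := by gcongr
    have h6 : W x = x ^ p * V x := rfl
    linarith
  exact IsBigO.of_pow two_ne_zero hsq

theorem bessel_isBigO {B : ℝ} (hB : 1 ≤ B) :
    bessel B =O[atTop] fun x => x ^ (-(B / 2 - 1 / 4)) := by
  refine isBigO_of_bessel_equation hB (hasDerivAt_bessel hB)
    (fun x => (hasDerivAt_bessel (B := B + 1) (by linarith) x).const_mul (-(1 / B))) fun x => ?_
  have h := bessel_contiguous hB x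
  rw [add_assoc, one_add_one_eq_two, h]
  field_simp
  ring

/-- One constant on all of `[1, ∞)` is needed, because the bound is applied under an integral at `x
* s`. Compactness covers the initial segment. -/
theorem exists_abs_bessel_le {B : ℝ} (hB : 1 ≤ B) :
    ∃ C, 0 ≤ C ∧ ∀ x, 1 ≤ x → |bessel B x| ≤ C * x ^ (-(B / 2 - 1 / 4)) := by
  obtain ⟨C, hC⟩ := (bessel_isBigO hB).bound
  obtain ⟨X, hX⟩ := eventually_atTop.1 hC
  have hcont : ContinuousOn (fun x : ℝ => |bessel B x| / x ^ (-(B / 2 - 1 / 4))) (Icc 1 X) := by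
    refine (continuous_bessel hB).abs.continuousOn.div ?_ ?_
    · exact continuousOn_id.rpow_const fun x hx => Or.inl (by have := hx.1; simp; linarith)
    · intro x hx
      exact (Real.rpow_pos_of_pos (by linarith [hx.1]) _).ne'
  obtain ⟨M, hM⟩ := (isCompact_Icc.bddAbove_image hcont)
  refine ⟨max 0 (max C M), le_max_left _ _, fun x hx => ?_⟩
  have hpos : 0 < x ^ (-(B / 2 - 1 / 4)) := Real.rpow_pos_of_pos (by linarith) _
  by_cases h : X ≤ x
  · have := hX x h
    rw [Real.norm_eq_abs, Real.norm_of_nonneg hpos.le] at this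
    refine this.trans ?_
    gcongr
    exact (le_max_left _ _).trans (le_max_right _ _)
  · have := hM ⟨x, ⟨hx, (not_le.1 h).le⟩, rfl⟩
    rw [← div_le_iff₀ hpos]
    exact this.trans ((le_max_right _ _).trans (le_max_right _ _))

/-! ### Beta, Laplace and Mellin integrals -/

theorem Gamma_add_natCast_eq {c : ℝ} (hc : 0 < c) (k : ℕ) :
    Real.Gamma (c + k) = (ascPochhammer ℝ k).eval c * Real.Gamma c := by
  induction k with
  | zero => simp
  | succ k ih =>
    rw [ascPochhammer_succ_eval, Nat.cast_add_one, ← add_assoc,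
      Real.Gamma_add_one (by positivity), ih]
    ring

theorem integral_rpow_mul_one_sub_rpow {c d : ℝ} (hc : 0 < c) (hd : 0 < d) :
    ∫ u in Ioc (0 : ℝ) 1, u ^ (c - 1) * (1 - u) ^ (d - 1)
      = Real.Gamma c * Real.Gamma d / Real.Gamma (c + d) := by
  have h := Complex.betaIntegral_eq_Gamma_mul_div c d (by simpa) (by simpa)
  rw [Complex.betaIntegral, intervalIntegral.integral_of_le zero_le_one] at h
  have e : ∫ u in Ioc (0 : ℝ) 1, (u : ℂ) ^ ((c : ℂ) - 1) * (1 - (u : ℂ)) ^ ((d : ℂ) - 1)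
      = ∫ u in Ioc (0 : ℝ) 1, ((u ^ (c - 1) * (1 - u) ^ (d - 1) : ℝ) : ℂ) := by
    refine setIntegral_congr_fun measurableSet_Ioc fun u hu => ?_
    rw [Complex.ofReal_mul, Complex.ofReal_cpow hu.1.le,
      Complex.ofReal_cpow (sub_nonneg.2 hu.2)]
    push_cast
    rfl
  rw [e, integral_complex_ofReal, ← Complex.ofReal_add] at h
  simp only [Complex.Gamma_ofReal] at h
  exact_mod_cast h

theorem integrableOn_rpow_mul_one_sub_rpow {c d : ℝ} (hc : 0 < c) (hd : 1 ≤ d) :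
    IntegrableOn (fun u : ℝ => u ^ (c - 1) * (1 - u) ^ (d - 1)) (Ioc 0 1) := by
  have h : IntegrableOn (fun u : ℝ => u ^ (c - 1)) (Ioc 0 1) :=
    (intervalIntegrable_iff_integrableOn_Ioc_of_le zero_le_one).1
      (intervalIntegral.intervalIntegrable_rpow' (by linarith))
  refine Integrable.mono' h (by fun_prop) ?_
  filter_upwards [ae_restrict_mem measurableSet_Ioc] with u hu
  have h1 : 0 ≤ 1 - u := sub_nonneg.2 hu.2
  have h2 : 0 ≤ u := hu.1.le
  rw [Real.norm_of_nonneg (by positivity)]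
  exact mul_le_of_le_one_right (by positivity)
    (Real.rpow_le_one h1 (by linarith) (by linarith))

theorem integrableOn_rpow_mul_exp_neg_mul {c ε : ℝ} (hc : 0 < c) (hε : 0 < ε) :
    IntegrableOn (fun t : ℝ => t ^ (c - 1) * Real.exp (-(ε * t))) (Ioi 0) := by
  have h := integrableOn_rpow_mul_exp_neg_mul_rpow (p := 1) (s := c - 1) (b := ε)
    (by linarith) one_pos hε
  simpa using h

theorem summable_eval_mul_besselTerm {c B : ℝ} (hc : 0 < c) (hcB : c ≤ B) (y : ℝ) :
    Summable fun k => (ascPochhammer ℝ k).eval c / (ascPochhammer ℝ k).eval B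
      * (y ^ k / (k.factorial : ℝ)) := by
  refine Summable.of_norm_bounded (Real.summable_pow_div_factorial |y|) fun k => ?_
  have h1 := rising_mono k hc.le hcB
  rw [norm_mul, Real.norm_of_nonneg (div_nonneg h1.1 (h1.1.trans h1.2)), norm_div, norm_pow,
    Real.norm_natCast, Real.norm_eq_abs]
  exact mul_le_of_le_one_left (by positivity) (div_le_one_of_le₀ h1.2 (h1.1.trans h1.2))

/-- The Laplace transform of `t ^ (c - 1) ₀F₁(B; -t)` as a series in `1 / ε`. -/
theorem integral_rpow_mul_exp_mul_bessel {c B ε : ℝ} (hc : 0 < c) (hcB : c ≤ B)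
    (hε : 0 < ε) :
    ∫ t in Ioi (0 : ℝ), t ^ (c - 1) * Real.exp (-(ε * t)) * bessel B t
      = (1 / ε) ^ c * Real.Gamma c *
        ∑' k, (ascPochhammer ℝ k).eval c / (ascPochhammer ℝ k).eval B
          * ((-(1 / ε)) ^ k / (k.factorial : ℝ)) := by
  set F : ℕ → ℝ → ℝ := fun k t => ((-1) ^ k / ((ascPochhammer ℝ k).eval B * (k.factorial : ℝ)))
    * (t ^ (c + k - 1) * Real.exp (-(ε * t))) with hF
  have hcoef : ∀ k : ℕ, |(-1 : ℝ) ^ k / ((ascPochhammer ℝ k).eval B * (k.factorial : ℝ))|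
      = 1 / ((ascPochhammer ℝ k).eval B * (k.factorial : ℝ)) := by
    intro k
    have := (ascPochhammer_pos k B (hc.trans_le hcB))
    rw [abs_div, abs_pow, abs_neg, abs_one, one_pow, abs_of_pos (by positivity)]
  have hck : ∀ k : ℕ, 0 < c + k := fun k => by positivity
  have hint : ∀ k : ℕ, ∫ t in Ioi (0 : ℝ), t ^ (c + k - 1) * Real.exp (-(ε * t))
      = (1 / ε) ^ c * Real.Gamma c * ((ascPochhammer ℝ k).eval c * (1 / ε) ^ k) := by
    intro k
    rw [Real.integral_rpow_mul_exp_neg_mul_Ioi (hck k) hε, Gamma_add_natCast_eq hc,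
      Real.rpow_add (by positivity), Real.rpow_natCast]
    ring
  have hFint : ∀ k, IntegrableOn (F k) (Ioi 0) := fun k =>
    (integrableOn_rpow_mul_exp_neg_mul (hck k) hε).const_mul _
  have hnorm : ∀ k, ∫ t in Ioi (0 : ℝ), ‖F k t‖ = (1 / ε) ^ c * Real.Gamma c *
      ((ascPochhammer ℝ k).eval c / (ascPochhammer ℝ k).eval B
          * ((1 / ε) ^ k / (k.factorial : ℝ))) := by
    intro k
    have : ∫ t in Ioi (0 : ℝ), ‖F k t‖ = ∫ t in Ioi (0 : ℝ),
        1 / ((ascPochhammer ℝ k).eval B * (k.factorial : ℝ)) *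
          (t ^ (c + k - 1) * Real.exp (-(ε * t))) := by
      refine setIntegral_congr_fun measurableSet_Ioi fun t ht => ?_
      simp only [hF]
      have ht' : (0 : ℝ) ≤ t := le_of_lt ht
      rw [norm_mul, Real.norm_eq_abs, hcoef, Real.norm_of_nonneg (by positivity)]
    rw [this, integral_const_mul, hint]
    ring
  -- Taking norms only removes the signs, giving the same series at `+1 / ε`; it converges because
  -- `c ≤ B` makes the ratios of rising factorials at most 1.
  have key := hasSum_integral_of_summable_integral_norm hFint (by
    simp only [hnorm]
    exact (summable_eval_mul_besselTerm hc hcB (1 / ε)).mul_left _)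
  have hsum : ∫ t in Ioi (0 : ℝ), t ^ (c - 1) * Real.exp (-(ε * t)) * bessel B t
      = ∫ t in Ioi (0 : ℝ), ∑' k, F k t := by
    refine setIntegral_congr_fun measurableSet_Ioi fun t ht => ?_
    simp only [bessel]
    rw [← tsum_mul_left]
    refine tsum_congr fun k => ?_
    have ht' : (0 : ℝ) < t := ht
    simp only [hF, besselTerm]
    rw [show c + k - 1 = c - 1 + k by ring, Real.rpow_add ht', Real.rpow_natCast, neg_pow]
    ring
  rw [hsum, ← key.tsum_eq, ← tsum_mul_left]
  refine tsum_congr fun k => ?_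
  simp only [hF]
  rw [integral_const_mul, hint, neg_pow (1 / ε)]
  ring

/-- Euler's integral for `₁F₁(c; B; -y)`. -/
theorem integral_rpow_mul_one_sub_rpow_mul_exp {c B : ℝ} (y : ℝ) (hc : 0 < c) (hcB : c + 1 ≤ B) :
    ∫ u in Ioc (0 : ℝ) 1, u ^ (c - 1) * (1 - u) ^ (B - c - 1) * Real.exp (-(y * u))
      = Real.Gamma c * Real.Gamma (B - c) / Real.Gamma B *
        ∑' k, (ascPochhammer ℝ k).eval c / (ascPochhammer ℝ k).eval B
          * ((-y) ^ k / (k.factorial : ℝ)) := by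
  set F : ℕ → ℝ → ℝ := fun k u => ((-y) ^ k / (k.factorial : ℝ))
    * (u ^ (c + k - 1) * (1 - u) ^ (B - c - 1)) with hF
  have hck : ∀ k : ℕ, 0 < c + k := fun k => by positivity
  have hBc : 1 ≤ B - c := by linarith
  have hB0 : 0 < B := by linarith
  have hint : ∀ k : ℕ, ∫ u in Ioc (0 : ℝ) 1, u ^ (c + k - 1) * (1 - u) ^ (B - c - 1)
      = Real.Gamma c * Real.Gamma (B - c) / Real.Gamma B *
        ((ascPochhammer ℝ k).eval c / (ascPochhammer ℝ k).eval B) := by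
    intro k
    rw [integral_rpow_mul_one_sub_rpow (hck k) (by linarith), show c + k + (B - c) = B + k by ring,
      Gamma_add_natCast_eq hc, Gamma_add_natCast_eq hB0]
    have h1 := Real.Gamma_pos_of_pos hB0
    have h2 := ascPochhammer_pos k B hB0
    field_simp
  have hFint : ∀ k, IntegrableOn (F k) (Ioc 0 1) := fun k =>
    (integrableOn_rpow_mul_one_sub_rpow (hck k) hBc).const_mul _
  have hnorm : ∀ k, ∫ u in Ioc (0 : ℝ) 1, ‖F k u‖
      = Real.Gamma c * Real.Gamma (B - c) / Real.Gamma B *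
      ((ascPochhammer ℝ k).eval c / (ascPochhammer ℝ k).eval B
          * (|y| ^ k / (k.factorial : ℝ))) := by
    intro k
    have : ∫ u in Ioc (0 : ℝ) 1, ‖F k u‖ = ∫ u in Ioc (0 : ℝ) 1,
        |y| ^ k / (k.factorial : ℝ) * (u ^ (c + k - 1) * (1 - u) ^ (B - c - 1)) := by
      refine setIntegral_congr_fun measurableSet_Ioc fun u hu => ?_
      simp only [hF]
      have h1 : 0 ≤ 1 - u := sub_nonneg.2 hu.2
      have h2 : 0 ≤ u := hu.1.le
      rw [norm_mul, Real.norm_of_nonneg (mul_nonneg (by positivity) (by positivity)), norm_div,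
        norm_pow, norm_neg, Real.norm_natCast, Real.norm_eq_abs]
    rw [this, integral_const_mul, hint]
    ring
  have key := hasSum_integral_of_summable_integral_norm hFint (by
    simp only [hnorm]
    exact (summable_eval_mul_besselTerm hc (by linarith) |y|).mul_left _)
  have hsum : ∫ u in Ioc (0 : ℝ) 1, u ^ (c - 1) * (1 - u) ^ (B - c - 1) * Real.exp (-(y * u))
      = ∫ u in Ioc (0 : ℝ) 1, ∑' k, F k u := by
    refine setIntegral_congr_fun measurableSet_Ioc fun u hu => ?_
    rw [Real.exp_eq_exp_ℝ, NormedSpace.exp_eq_tsum_div, ← tsum_mul_left]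
    refine tsum_congr fun k => ?_
    simp only [hF]
    rw [show c + k - 1 = c - 1 + k by ring, Real.rpow_add hu.1, Real.rpow_natCast,
      neg_mul_eq_neg_mul, mul_pow]
    ring
  rw [hsum, ← key.tsum_eq, ← tsum_mul_left]
  refine tsum_congr fun k => ?_
  simp only [hF]
  rw [integral_const_mul, hint]
  ring

/-- Watson's lemma to leading order: with `v = y * u` the factor `(1 - v / y) ^ (d - 1)` tends to 1,
and `1 ≤ d` keeps it at most 1, so `v ^ (c - 1) * exp (-v)` dominates. -/
theorem tendsto_rpow_mul_integral_one_sub_rpow_mul_exp {c d : ℝ} (hc : 0 < c) (hd : 1 ≤ d) :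
    Tendsto (fun y : ℝ => y ^ c *
      ∫ u in Ioc (0 : ℝ) 1, u ^ (c - 1) * (1 - u) ^ (d - 1) * Real.exp (-(y * u)))
      atTop (𝓝 (Real.Gamma c)) := by
  set G : ℝ → ℝ → ℝ := fun y v =>
    (Ioc 0 y).indicator (fun v => v ^ (c - 1) * (1 - v / y) ^ (d - 1) * Real.exp (-v)) v with hG
  have h1 : Tendsto (fun y => ∫ v in Ioi (0 : ℝ), G y v) atTop
      (𝓝 (∫ v in Ioi (0 : ℝ), v ^ (c - 1) * Real.exp (-v))) := by
    refine tendsto_integral_filter_of_dominated_convergence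
      (fun v => v ^ (c - 1) * Real.exp (-v)) ?_ ?_ ?_ ?_
    · refine Eventually.of_forall fun y => Measurable.aestronglyMeasurable ?_
      exact Measurable.indicator (by fun_prop) measurableSet_Ioc
    · refine Eventually.of_forall fun y => ?_
      filter_upwards [ae_restrict_mem measurableSet_Ioi] with v hv
      have hv' : (0 : ℝ) < v := hv
      simp only [hG, indicator]
      split_ifs with h
      · have hy : 0 < y := h.1.trans_le h.2
        have h2 : 0 ≤ 1 - v / y := sub_nonneg.2 ((div_le_one hy).2 h.2)
        have h3 : (1 - v / y) ^ (d - 1) ≤ 1 :=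
          Real.rpow_le_one h2 (by have : 0 ≤ v / y := by positivity
                                  linarith) (by linarith)
        rw [Real.norm_of_nonneg (by positivity)]
        gcongr
        exact mul_le_of_le_one_right (by positivity) h3
      · rw [norm_zero]; positivity
    · simpa [IntegrableOn] using integrableOn_rpow_mul_exp_neg_mul hc one_pos
    · filter_upwards [ae_restrict_mem measurableSet_Ioi] with v hv
      have hv' : (0 : ℝ) < v := hv
      have h2 : Tendsto (fun y : ℝ => (1 - v / y) ^ (d - 1)) atTop (𝓝 1) := by
        have h3 : Tendsto (fun y : ℝ => 1 - v / y) atTop (𝓝 (1 - 0)) :=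
          tendsto_const_nhds.sub (tendsto_const_nhds.div_atTop tendsto_id)
        have h4 := h3.rpow_const (p := d - 1) (Or.inl (by norm_num))
        simpa using h4
      have h5 := (h2.const_mul (v ^ (c - 1))).mul_const (Real.exp (-v))
      rw [mul_one] at h5
      refine h5.congr' ?_
      filter_upwards [eventually_ge_atTop v] with y hy
      simp only [hG]
      rw [indicator_of_mem (show v ∈ Ioc 0 y from ⟨hv', hy⟩)]
  have h2 : Real.Gamma c = ∫ v in Ioi (0 : ℝ), v ^ (c - 1) * Real.exp (-v) := by
    rw [Real.Gamma_eq_integral hc]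
    simp only [mul_comm]
  rw [h2]
  refine h1.congr' ?_
  filter_upwards [eventually_gt_atTop 0] with y hy
  have h3 := integral_comp_mul_left_Ioi (G y) 0 hy
  rw [mul_zero, smul_eq_mul] at h3
  have h4 : ∫ v in Ioi (0 : ℝ), G y v = y * ∫ u in Ioi (0 : ℝ), G y (y * u) := by
    rw [h3]; field_simp
  rw [h4]
  have h5 : ∀ u, G y (y * u) = (Ioc (0 : ℝ) 1).indicator
      (fun u => y ^ (c - 1) * (u ^ (c - 1) * (1 - u) ^ (d - 1) * Real.exp (-(y * u)))) u := by
    intro u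
    simp only [hG, indicator]
    have : y * u ∈ Ioc 0 y ↔ u ∈ Ioc (0 : ℝ) 1 := by
      simp [hy]
    by_cases hu : u ∈ Ioc (0 : ℝ) 1
    · rw [if_pos hu, if_pos (this.2 hu), Real.mul_rpow hy.le hu.1.le, mul_div_cancel_left₀ _ hy.ne']
      ring
    · rw [if_neg hu, if_neg (mt this.1 hu)]
  simp only [h5]
  rw [setIntegral_indicator measurableSet_Ioc,
    inter_eq_self_of_subset_right Ioc_subset_Ioi_self, integral_const_mul, ← mul_assoc,
    mul_comm y, ← Real.rpow_add_one hy.ne', sub_add_cancel]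

theorem bessel_isBigO_nhdsGT_zero {B : ℝ} (hB : 1 ≤ B) :
    bessel B =O[𝓝[>] 0] fun x => x ^ (-(0 : ℝ)) := by
  have h := ((continuous_bessel hB).tendsto 0).isBigO_one ℝ
  simpa using h.mono nhdsWithin_le_nhds

theorem integrableOn_rpow_mul_bessel {c B : ℝ} (hB : 1 ≤ B) (hc : 0 < c)
    (hcB : c < B / 2 - 1 / 4) :
    IntegrableOn (fun t : ℝ => t ^ (c - 1) * bessel B t) (Ioi 0) :=
  mellin_convergent_of_isBigO_scalar ((continuous_bessel hB).locallyIntegrable.locallyIntegrableOn _)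
    (bessel_isBigO hB) hcB (bessel_isBigO_nhdsGT_zero hB) hc

/-- The Mellin transform of `₀F₁(B; -t)`. -/
theorem integral_rpow_mul_bessel {c B : ℝ} (hB : 1 ≤ B) (hc : 0 < c)
    (hcB : c < B / 2 - 1 / 4) (hcB' : c + 1 ≤ B) :
    ∫ t in Ioi (0 : ℝ), t ^ (c - 1) * bessel B t
      = Real.Gamma c * Real.Gamma B / Real.Gamma (B - c) := by
  have hB0 : 0 < B := by linarith
  have hBc : 0 < B - c := by linarith
  -- Abel regularisation: termwise integration needs the damping `exp (-t / y)`. The damped integral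
  -- is a multiple of `y ^ c * ₁F₁(c; B; -y)`, whose limit is read off from Euler's integral.
  have h1 : Tendsto (fun y : ℝ =>
      ∫ t in Ioi (0 : ℝ), t ^ (c - 1) * Real.exp (-(1 / y * t)) * bessel B t) atTop
      (𝓝 (∫ t in Ioi (0 : ℝ), t ^ (c - 1) * bessel B t)) := by
    refine tendsto_integral_filter_of_dominated_convergence
      (fun t => |t ^ (c - 1) * bessel B t|) ?_ ?_ (integrableOn_rpow_mul_bessel hB hc hcB).abs ?_
    · refine Eventually.of_forall fun y => Measurable.aestronglyMeasurable ?_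
      have := (continuous_bessel hB).measurable
      fun_prop
    · filter_upwards [eventually_gt_atTop 0] with y hy
      filter_upwards [ae_restrict_mem measurableSet_Ioi] with t ht
      have ht' : (0 : ℝ) < t := ht
      rw [mul_right_comm, norm_mul, Real.norm_eq_abs, Real.norm_of_nonneg (Real.exp_nonneg _)]
      refine mul_le_of_le_one_right (abs_nonneg _) (Real.exp_le_one_iff.2 ?_)
      rw [neg_nonpos]; positivity
    · refine Eventually.of_forall fun t => ?_
      have h3 : Tendsto (fun y : ℝ => Real.exp (-(1 / y * t))) atTop (𝓝 1) := by
        have h4 : Tendsto (fun y : ℝ => -(1 / y * t)) atTop (𝓝 (-(0 * t))) :=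
          ((tendsto_const_nhds.div_atTop tendsto_id).mul_const t).neg
        have h5 := (Real.continuous_exp.tendsto _).comp h4
        simpa [Function.comp_def] using h5
      simpa using (h3.const_mul (t ^ (c - 1))).mul_const (bessel B t)
  have h2 := (tendsto_rpow_mul_integral_one_sub_rpow_mul_exp hc
    (d := B - c) (by linarith)).mul_const (Real.Gamma B / Real.Gamma (B - c))
  rw [mul_div_assoc]
  refine tendsto_nhds_unique h1 (h2.congr' ?_)
  filter_upwards [eventually_gt_atTop 0] with y hy
  rw [integral_rpow_mul_exp_mul_bessel hc (by linarith) (by positivity : 0 < 1 / y), one_div_one_div,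
    integral_rpow_mul_one_sub_rpow_mul_exp y hc hcB']
  have h3 := Real.Gamma_pos_of_pos hB0
  have h4 := Real.Gamma_pos_of_pos hBc
  field_simp

/-! ### Weighted series and their integrals over the unit interval -/

/-- The series `∑ t_k / (c + k)`, where `t_k` are the terms of `₀F₁(B; -x)`. -/
def besselPrim (c B x : ℝ) : ℝ := ∑' k : ℕ, 1 / (c + k) * besselTerm B x k

/-- The series `∑ t_k / (1 + k) ^ 2`, where `t_k` are the terms of `₀F₁(B; -x)`. -/
def besselPrimSq (B x : ℝ) : ℝ := ∑' k : ℕ, 1 / (1 + (k : ℝ)) ^ 2 * besselTerm B x k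

theorem abs_one_div_add_natCast_le {c : ℝ} (hc : 0 < c) (k : ℕ) : |1 / (c + k)| ≤ 1 / c := by
  rw [abs_of_pos (by positivity)]
  gcongr
  simp

theorem abs_one_div_one_add_natCast_sq_le (k : ℕ) : |1 / (1 + (k : ℝ)) ^ 2| ≤ 1 := by
  rw [abs_of_pos (by positivity), div_le_one (by positivity)]
  exact one_le_pow₀ (by simp)

theorem summable_besselPrim {c B : ℝ} (hc : 0 < c) (hB : 1 ≤ B) (x : ℝ) :
    Summable fun k : ℕ => 1 / (c + k) * besselTerm B x k :=
  summable_mul_besselTerm hB x (abs_one_div_add_natCast_le hc)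

theorem summable_besselPrimSq {B : ℝ} (hB : 1 ≤ B) (x : ℝ) :
    Summable fun k : ℕ => 1 / (1 + (k : ℝ)) ^ 2 * besselTerm B x k :=
  summable_mul_besselTerm hB x abs_one_div_one_add_natCast_sq_le

/-- Write `B + k = (c + k) + (B - c)`; the first summand cancels the denominator. -/
theorem besselPrim_contiguous {c B : ℝ} (hc : 0 < c) (hB : 1 ≤ B) (x : ℝ) :
    besselPrim c B x = 1 / B * bessel (B + 1) x + (B - c) / B * besselPrim c (B + 1) x := by
  have hB1 : 1 ≤ B + 1 := by linarith
  rw [besselPrim, besselPrim, bessel, ← tsum_mul_left, ← tsum_mul_left,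
    ← ((summable_besselTerm hB1 x).mul_left _).tsum_add ((summable_besselPrim hc hB1 x).mul_left _)]
  refine tsum_congr fun k => ?_
  rw [besselTerm_contiguous hB]
  have : 0 < c + k := by positivity
  field_simp
  ring

theorem besselPrimSq_contiguous {B : ℝ} (hB : 1 ≤ B) (x : ℝ) :
    besselPrimSq B x = 1 / B * besselPrim 1 (B + 1) x + (B - 1) / B * besselPrimSq (B + 1) x := by
  have hB1 : 1 ≤ B + 1 := by linarith
  rw [besselPrimSq, besselPrimSq, besselPrim, ← tsum_mul_left, ← tsum_mul_left,
    ← ((summable_besselPrim one_pos hB1 x).mul_left _).tsum_add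
      ((summable_besselPrimSq hB1 x).mul_left _)]
  refine tsum_congr fun k => ?_
  rw [besselTerm_contiguous hB]
  have : 0 < 1 + (k : ℝ) := by positivity
  field_simp
  ring

theorem besselTerm_mul (B x s : ℝ) (k : ℕ) :
    besselTerm B (x * s) k = besselTerm B x k * s ^ k := by
  rw [besselTerm, besselTerm, neg_mul_eq_neg_mul, mul_pow]
  ring

theorem integral_rpow_mul_bessel_Ioc {c B : ℝ} (hc : 0 < c) (hB : 1 ≤ B) (x : ℝ) :
    ∫ s in Ioc (0 : ℝ) 1, s ^ (c - 1) * bessel B (x * s) = besselPrim c B x := by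
  set F : ℕ → ℝ → ℝ := fun k s => besselTerm B x k * s ^ (c + k - 1) with hF
  have hck : ∀ k : ℕ, 0 < c + k := fun k => by positivity
  have hint : ∀ k : ℕ, ∫ s in Ioc (0 : ℝ) 1, s ^ (c + k - 1) = 1 / (c + k) := by
    intro k
    rw [← intervalIntegral.integral_of_le zero_le_one,
      integral_rpow (Or.inl (by linarith [hck k])), sub_add_cancel, Real.one_rpow,
      Real.zero_rpow (hck k).ne', sub_zero]
  have hFint : ∀ k, IntegrableOn (F k) (Ioc 0 1) := fun k =>
    Integrable.const_mul ((intervalIntegrable_iff_integrableOn_Ioc_of_le zero_le_one).1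
      (intervalIntegral.intervalIntegrable_rpow' (by linarith [hck k]))) _
  have hnorm : ∀ k, ∫ s in Ioc (0 : ℝ) 1, ‖F k s‖ = ‖1 / (c + k) * besselTerm B x k‖ := by
    intro k
    have : ∫ s in Ioc (0 : ℝ) 1, ‖F k s‖
        = ∫ s in Ioc (0 : ℝ) 1, ‖besselTerm B x k‖ * s ^ (c + k - 1) := by
      refine setIntegral_congr_fun measurableSet_Ioc fun s hs => ?_
      have h2 : 0 ≤ s := hs.1.le
      simp only [hF]
      rw [norm_mul, Real.norm_of_nonneg (Real.rpow_nonneg h2 _)]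
    rw [this, integral_const_mul, hint, norm_mul, mul_comm,
      Real.norm_of_nonneg (r := 1 / (c + k)) (one_div_nonneg.2 (hck k).le)]
  have key := hasSum_integral_of_summable_integral_norm hFint (by
    simp only [hnorm]
    exact (summable_besselPrim hc hB x).norm)
  have hsum : ∫ s in Ioc (0 : ℝ) 1, s ^ (c - 1) * bessel B (x * s)
      = ∫ s in Ioc (0 : ℝ) 1, ∑' k, F k s := by
    refine setIntegral_congr_fun measurableSet_Ioc fun s hs => ?_
    simp only [bessel]
    rw [← tsum_mul_left]
    refine tsum_congr fun k => ?_
    simp only [hF]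
    rw [besselTerm_mul, show c + k - 1 = c - 1 + k by ring, Real.rpow_add hs.1, Real.rpow_natCast]
    ring
  rw [hsum, ← key.tsum_eq, besselPrim]
  refine tsum_congr fun k => ?_
  simp only [hF]
  rw [integral_const_mul, hint, mul_comm]

theorem intervalIntegrable_pow_mul_log (k : ℕ) :
    IntervalIntegrable (fun s : ℝ => s ^ k * Real.log s) volume 0 1 :=
  intervalIntegral.intervalIntegrable_log'.continuousOn_mul (by fun_prop)

theorem integral_pow_mul_log (k : ℕ) :
    ∫ s in Ioc (0 : ℝ) 1, s ^ k * Real.log s = -(1 / (1 + (k : ℝ)) ^ 2) := by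
  have hk : (k : ℝ) + 1 ≠ 0 := by positivity
  rw [← intervalIntegral.integral_of_le zero_le_one,
    intervalIntegral.integral_eq_sub_of_hasDerivAt_of_le (f := fun s : ℝ =>
      s ^ k * (s * Real.log s) / (k + 1) - s ^ (k + 1) / (k + 1) ^ 2) zero_le_one
      ?_ ?_ (intervalIntegrable_pow_mul_log k)]
  · simp
    ring
  · have := Real.continuous_mul_log
    fun_prop
  · intro s hs
    have h1 := ((hasDerivAt_pow (k + 1) s).mul (Real.hasDerivAt_log hs.1.ne')).div_const
      ((k : ℝ) + 1)
    have h2 := (hasDerivAt_pow (k + 1) s).div_const (((k : ℝ) + 1) ^ 2)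
    have h3 : (fun s : ℝ => s ^ k * (s * Real.log s) / (k + 1) - s ^ (k + 1) / (k + 1) ^ 2)
        = fun s : ℝ => s ^ (k + 1) * Real.log s / (k + 1) - s ^ (k + 1) / (k + 1) ^ 2 := by
      funext s; ring
    rw [h3]
    refine (h1.sub h2).congr_deriv ?_
    have := hs.1.ne'
    simp only [Nat.add_sub_cancel, pow_succ]
    push_cast
    field_simp
    ring

/-- Termwise, `∫₀¹ s^k log s ds = -1 / (1 + k)²`; the logarithm has constant sign on the interval,
so absolute values do not spoil the series. -/
theorem integral_log_mul_bessel_Ioc {B : ℝ} (hB : 1 ≤ B) (x : ℝ) :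
    ∫ s in Ioc (0 : ℝ) 1, Real.log s * bessel B (x * s) = -besselPrimSq B x := by
  set F : ℕ → ℝ → ℝ := fun k s => besselTerm B x k * (s ^ k * Real.log s) with hF
  have hFint : ∀ k, IntegrableOn (F k) (Ioc 0 1) := fun k =>
    Integrable.const_mul ((intervalIntegrable_iff_integrableOn_Ioc_of_le zero_le_one).1
      (intervalIntegrable_pow_mul_log k)) _
  have hnorm : ∀ k, ∫ s in Ioc (0 : ℝ) 1, ‖F k s‖
      = ‖1 / (1 + (k : ℝ)) ^ 2 * besselTerm B x k‖ := by
    intro k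
    have : ∫ s in Ioc (0 : ℝ) 1, ‖F k s‖
        = ∫ s in Ioc (0 : ℝ) 1, -‖besselTerm B x k‖ * (s ^ k * Real.log s) := by
      refine setIntegral_congr_fun measurableSet_Ioc fun s hs => ?_
      have h2 : 0 ≤ s ^ k := pow_nonneg hs.1.le k
      have h3 := Real.log_nonpos hs.1.le hs.2
      simp only [hF]
      rw [norm_mul, Real.norm_of_nonpos (r := s ^ k * _) (mul_nonpos_of_nonneg_of_nonpos h2 h3)]
      ring
    rw [this, integral_const_mul, integral_pow_mul_log, norm_mul,
      Real.norm_of_nonneg (r := 1 / _) (by positivity)]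
    ring
  have key := hasSum_integral_of_summable_integral_norm hFint (by
    simp only [hnorm]
    exact (summable_besselPrimSq hB x).norm)
  have hsum : ∫ s in Ioc (0 : ℝ) 1, Real.log s * bessel B (x * s)
      = ∫ s in Ioc (0 : ℝ) 1, ∑' k, F k s := by
    refine setIntegral_congr_fun measurableSet_Ioc fun s hs => ?_
    simp only [bessel]
    rw [← tsum_mul_left]
    refine tsum_congr fun k => ?_
    simp only [hF]
    rw [besselTerm_mul]
    ring
  rw [hsum, ← key.tsum_eq, besselPrimSq, ← tsum_neg]
  refine tsum_congr fun k => ?_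
  simp only [hF]
  rw [integral_const_mul, integral_pow_mul_log]
  ring

/-! ### The digamma function and the logarithmic moment -/

theorem hasDerivAt_Gamma_of_pos {x : ℝ} (hx : 0 < x) :
    HasDerivAt Real.Gamma (digamma x * Real.Gamma x) x := by
  have h := (Complex.differentiableAt_Gamma (x : ℂ) fun m h => by
    have h' : x = -(m : ℝ) := by exact_mod_cast h
    have : (0 : ℝ) ≤ m := m.cast_nonneg
    linarith).hasDerivAt.real_of_complex
  simp only [Complex.Gamma_ofReal, Complex.ofReal_re] at h
  refine h.congr_deriv ?_
  rw [digamma, Complex.digamma_def, logDeriv_apply, Complex.Gamma_ofReal, Complex.div_ofReal_re,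
    div_mul_cancel₀ _ (Real.Gamma_pos_of_pos hx).ne']

theorem digamma_one : digamma 1 = -Real.eulerMascheroniConstant := by
  simp [digamma, Complex.digamma_one]

theorem digamma_add_one {x : ℝ} (hx : 0 < x) : digamma (x + 1) = digamma x + 1 / x := by
  have h := Complex.digamma_apply_add_one (x : ℂ) fun m h => by
    have h' : x = -(m : ℝ) := by exact_mod_cast h
    have : (0 : ℝ) ≤ m := m.cast_nonneg
    linarith
  rw [digamma, digamma, Complex.ofReal_add, Complex.ofReal_one, h, Complex.add_re,
    ← Complex.ofReal_inv, Complex.ofReal_re, one_div]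

/-- The logarithmic moment of `₀F₁(B; -t)`. -/
theorem integral_log_mul_bessel {B : ℝ} (hB : 5 / 2 < B) :
    IntegrableOn (fun t => Real.log t * bessel B t) (Ioi 0) ∧
    ∫ t in Ioi (0 : ℝ), Real.log t * bessel B t
      = (B - 1) * (digamma (B - 1) - Real.eulerMascheroniConstant) := by
  have hB1 : 1 ≤ B := by linarith
  have hcont : Continuous fun t => (bessel B t : ℂ) :=
    Complex.continuous_ofReal.comp (continuous_bessel hB1)
  -- The factor `log t` is the derivative of `t ^ (c - 1)` in `c` at `c = 1`. The hypothesis `5 / 2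
  -- < B` says exactly that `1 < B / 2 - 1 / 4`, so 1 is interior to the strip where the closed form
  -- is known.
  obtain ⟨hconv, hder⟩ := mellin_hasDerivAt_of_isBigO_rpow (f := fun t => (bessel B t : ℂ))
    (s := ((1 : ℝ) : ℂ)) (a := B / 2 - 1 / 4) (b := 0)
    (hcont.locallyIntegrable.locallyIntegrableOn _)
    (Complex.isBigO_ofReal_left.2 (bessel_isBigO hB1)) (by simp; linarith)
    (Complex.isBigO_ofReal_left.2 (bessel_isBigO_nhdsGT_zero hB1)) (by simp)
  have hfun : ∀ t ∈ Ioi (0 : ℝ),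
      (t : ℂ) ^ (((1 : ℝ) : ℂ) - 1) • Real.log t • (bessel B t : ℂ)
        = ((Real.log t * bessel B t : ℝ) : ℂ) := by
    intro t _
    simp
  have hint : IntegrableOn (fun t => Real.log t * bessel B t) (Ioi 0) := by
    have := (integrableOn_congr_fun hfun measurableSet_Ioi).1 hconv
    exact this.re
  refine ⟨hint, ?_⟩
  have hval : (mellin (fun t => Real.log t • (bessel B t : ℂ)) ((1 : ℝ) : ℂ)).re
      = ∫ t in Ioi (0 : ℝ), Real.log t * bessel B t := by
    rw [mellin, setIntegral_congr_fun measurableSet_Ioi hfun, integral_complex_ofReal,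
      Complex.ofReal_re]
  have h1 := hder.real_of_complex
  rw [hval] at h1
  have h2 : (fun c : ℝ => (mellin (fun t => (bessel B t : ℂ)) (c : ℂ)).re)
      =ᶠ[𝓝 1] fun c => Real.Gamma c * Real.Gamma B / Real.Gamma (B - c) := by
    have hlt : (1 : ℝ) < min (B / 2 - 1 / 4) (B - 1) := lt_min (by linarith) (by linarith)
    filter_upwards [Ioo_mem_nhds zero_lt_one hlt] with c hc
    have hc2 := lt_min_iff.1 hc.2
    rw [← integral_rpow_mul_bessel hB1 hc.1 hc2.1 (by linarith), mellin]
    have : ∀ t ∈ Ioi (0 : ℝ), (t : ℂ) ^ ((c : ℂ) - 1) • (bessel B t : ℂ)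
        = ((t ^ (c - 1) * bessel B t : ℝ) : ℂ) := by
      intro t ht
      rw [Complex.ofReal_mul, Complex.ofReal_cpow (le_of_lt ht), smul_eq_mul]
      push_cast
      rfl
    rw [setIntegral_congr_fun measurableSet_Ioi this, integral_complex_ofReal, Complex.ofReal_re]
  have hB0 : 0 < B - 1 := by linarith
  have hG := (Real.Gamma_pos_of_pos hB0).ne'
  have h3 : HasDerivAt (fun c => Real.Gamma (B - c))
      (-(digamma (B - 1) * Real.Gamma (B - 1))) 1 :=
    (hasDerivAt_Gamma_of_pos hB0).comp_const_sub B 1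
  have h4 := ((hasDerivAt_Gamma_of_pos one_pos).mul_const (Real.Gamma B)).div h3 hG
  have h5 := (h1.congr_of_eventuallyEq h2.symm).unique h4
  have h6 : Real.Gamma B = (B - 1) * Real.Gamma (B - 1) := by
    rw [← Real.Gamma_add_one hB0.ne', sub_add_cancel]
  rw [h5, digamma_one, Real.Gamma_one, h6]
  field_simp
  ring

/-! ### Asymptotics of the series with simple denominators -/

/-- For `x, s ≥ 1` the decay bound splits as `x^(-q) s^(-q)`, and `s^(r-q)` is integrable on `(1,
∞)`. -/
theorem integral_Ioi_one_weight_mul_bessel_isBigO {B r : ℝ} {w : ℝ → ℝ} (hB : 1 ≤ B)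
    (hr : r < B / 2 - 1 / 4 - 1) (hw : ∀ s, 1 ≤ s → |w s| ≤ s ^ r) :
    (fun x => ∫ s in Ioi (1 : ℝ), w s * bessel B (x * s))
      =O[atTop] fun x => x ^ (-(B / 2 - 1 / 4)) := by
  obtain ⟨C, hC0, hC⟩ := exists_abs_bessel_le hB
  set q := B / 2 - 1 / 4 with hq
  refine IsBigO.of_bound (C * ∫ s in Ioi (1 : ℝ), s ^ (r - q)) ?_
  filter_upwards [eventually_ge_atTop 1] with x hx
  have hx0 : 0 < x := by linarith
  rw [Real.norm_of_nonneg (r := x ^ _) (by positivity), mul_right_comm, ← integral_const_mul]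
  refine norm_integral_le_of_norm_le
    ((integrableOn_Ioi_rpow_of_lt (by linarith) one_pos).const_mul _) ?_
  filter_upwards [ae_restrict_mem measurableSet_Ioi] with s hs
  have hs1 : (1 : ℝ) ≤ s := le_of_lt hs
  have hs0 : 0 < s := by linarith
  rw [norm_mul, Real.norm_eq_abs, Real.norm_eq_abs]
  calc |w s| * |bessel B (x * s)| ≤ s ^ r * (C * (x * s) ^ (-q)) := by
        gcongr
        · exact hw s hs1
        · exact hC _ (one_le_mul_of_one_le_of_one_le hx hs1)
    _ = C * x ^ (-q) * s ^ (r - q) := by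
        rw [Real.mul_rpow hx0.le hs0.le, sub_eq_add_neg, Real.rpow_add hs0]
        ring

/-- The leading coefficient of `besselPrim`. -/
def besselPrimCoeff (c B : ℝ) : ℝ := Real.Gamma c * Real.Gamma B / Real.Gamma (B - c)

theorem integral_Ioi_eq_Ioc_add_Ioi {g : ℝ → ℝ} (hg : IntegrableOn g (Ioi 0)) :
    ∫ s in Ioi (0 : ℝ), g s = (∫ s in Ioc (0 : ℝ) 1, g s) + ∫ s in Ioi (1 : ℝ), g s := by
  rw [← Ioc_union_Ioi_eq_Ioi (zero_le_one' ℝ)] at hg ⊢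
  exact setIntegral_union Ioc_disjoint_Ioi_same measurableSet_Ioi hg.left_of_union
    hg.right_of_union

/-- The difference is minus the tail over `(1, ∞)`: the substitution `t = x * s` turns the full
integral into the leading term. -/
theorem besselPrim_isBigO_of_lt {c B : ℝ} (hB : 1 ≤ B) (hc : 0 < c)
    (hcB : c < B / 2 - 1 / 4) (hcB' : c + 1 ≤ B) :
    (fun x => besselPrim c B x - besselPrimCoeff c B * x ^ (-c))
      =O[atTop] fun x => x ^ (-(B / 2 - 1 / 4)) := by
  have h := (integral_Ioi_one_weight_mul_bessel_isBigO (w := fun s => s ^ (c - 1)) (r := c - 1) hB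
    (by linarith) fun s hs => (abs_of_nonneg (by positivity)).le).neg_left
  refine h.congr' ?_ EventuallyEq.rfl
  filter_upwards [eventually_gt_atTop 0] with x hx
  have hi := integrableOn_rpow_mul_bessel hB hc hcB
  have e : ∀ s ∈ Ioi (0 : ℝ), (x * s) ^ (c - 1) * bessel B (x * s)
      = x ^ (c - 1) * (s ^ (c - 1) * bessel B (x * s)) := fun s hs => by
    rw [Real.mul_rpow hx.le (le_of_lt hs)]; ring
  have hx1 : x ^ (c - 1) ≠ 0 := (Real.rpow_pos_of_pos hx _).ne'
  have hi1 : IntegrableOn (fun s => s ^ (c - 1) * bessel B (x * s)) (Ioi 0) := by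
    have h1 := (integrableOn_Ioi_comp_mul_left_iff
      (fun t => t ^ (c - 1) * bessel B t) 0 hx).2 (by simpa using hi)
    have h2 := ((integrableOn_congr_fun e measurableSet_Ioi).1 h1).const_mul (x ^ (c - 1))⁻¹
    simpa [IntegrableOn, ← mul_assoc, inv_mul_cancel₀ hx1] using h2
  have h1 := integral_comp_mul_left_Ioi (fun t => t ^ (c - 1) * bessel B t) 0 hx
  rw [setIntegral_congr_fun measurableSet_Ioi e, integral_const_mul, mul_zero, smul_eq_mul,
    integral_rpow_mul_bessel hB hc hcB hcB', integral_Ioi_eq_Ioc_add_Ioi hi1,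
    integral_rpow_mul_bessel_Ioc hc hB] at h1
  have h2 : x⁻¹ = x ^ (c - 1) * x ^ (-c) := by
    rw [← Real.rpow_add hx, ← Real.rpow_neg_one]
    ring_nf
  rw [h2, mul_assoc] at h1
  have h3 := mul_left_cancel₀ hx1 h1
  rw [besselPrimCoeff]
  linarith

theorem besselPrimCoeff_contiguous {c B : ℝ} (hB : 1 ≤ B) :
    besselPrimCoeff c B = (B - c) / B * besselPrimCoeff c (B + 1) := by
  have hB0 : B ≠ 0 := by linarith
  rw [besselPrimCoeff, besselPrimCoeff, Real.Gamma_add_one hB0]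
  -- At the poles, `Real.Gamma` is 0 and division by 0 gives 0, matching the convention `1/Γ = 0`;
  -- the relation therefore survives there.
  by_cases h : B - c = 0
  · simp [h]
  · rw [show B + 1 - c = B - c + 1 by ring, Real.Gamma_add_one h]
    by_cases hG : Real.Gamma (B - c) = 0
    · simp [hG]
    · field_simp

theorem bessel_add_one_isBigO {B : ℝ} (hB : 1 ≤ B) :
    bessel (B + 1) =O[atTop] fun x => x ^ (-(B / 2 + 1 / 4)) := by
  have h := bessel_isBigO (B := B + 1) (by linarith)
  rwa [show (B + 1) / 2 - 1 / 4 = B / 2 + 1 / 4 by ring] at h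

theorem rpow_isBigO_rpow_of_le {p q : ℝ} (h : p ≤ q) :
    (fun x : ℝ => x ^ p) =O[atTop] fun x => x ^ q := by
  refine IsBigO.of_bound 1 ?_
  filter_upwards [eventually_ge_atTop 1] with x hx
  rw [Real.norm_of_nonneg (by positivity), Real.norm_of_nonneg (by positivity), one_mul]
  exact Real.rpow_le_rpow_of_exponent_le hx h

theorem besselPrim_isBigO_of_add_one {c B : ℝ} (hB : 1 ≤ B) (hc : 0 < c)
    (h : (fun x => besselPrim c (B + 1) x - besselPrimCoeff c (B + 1) * x ^ (-c))
      =O[atTop] fun x => x ^ (-(B / 2 + 1 / 4))) :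
    (fun x => besselPrim c B x - besselPrimCoeff c B * x ^ (-c))
      =O[atTop] fun x => x ^ (-(B / 2 + 1 / 4)) := by
  refine (((bessel_add_one_isBigO hB).const_mul_left (1 / B)).add
    (h.const_mul_left ((B - c) / B))).congr_left fun x => ?_
  rw [besselPrim_contiguous hc hB, besselPrimCoeff_contiguous hB]
  ring

/-- The asymptotic expansion of `∑ t_k / (c + k)`. -/
theorem besselPrim_isBigO {c B : ℝ} (hB : 1 ≤ B) (hc : 0 < c) :
    (fun x => besselPrim c B x - besselPrimCoeff c B * x ^ (-c))
      =O[atTop] fun x => x ^ (-(B / 2 + 1 / 4)) := by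
  obtain ⟨m, hm⟩ := exists_nat_gt (2 * c + 1)
  have hm' : 2 * c + 1 < B + m := by linarith
  clear hm
  induction m generalizing B with
  | zero =>
    -- Even when `B` is already large, the direct estimate only gives `x^(-(B/2-1/4))`. One passage
    -- through `B + 1` gains the factor `x^(-1/2)`.
    refine besselPrim_isBigO_of_add_one hB hc ?_
    norm_num at hm'
    have h := besselPrim_isBigO_of_lt (c := c) (B := B + 1) (by linarith) hc (by linarith)
      (by linarith)
    rwa [show (B + 1) / 2 - 1 / 4 = B / 2 + 1 / 4 by ring] at h
  | succ m ih =>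
    refine besselPrim_isBigO_of_add_one hB hc ?_
    push_cast at hm'
    exact (ih (B := B + 1) (by linarith) (by linarith)).trans
      (rpow_isBigO_rpow_of_le (by linarith))

theorem besselPrimCoeff_one {B : ℝ} (hB : 1 < B) : besselPrimCoeff 1 B = B - 1 := by
  have h0 : 0 < B - 1 := by linarith
  have h1 := Real.Gamma_add_one h0.ne'
  rw [sub_add_cancel] at h1
  rw [besselPrimCoeff, h1, Real.Gamma_one, one_mul,
    mul_div_cancel_right₀ _ (Real.Gamma_pos_of_pos h0).ne']

/-! ### Asymptotics of the series with squared denominators -/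

/-- The leading part of `besselPrimSq`. -/
def besselPrimSqLeading (B x : ℝ) : ℝ :=
  (B - 1) * x⁻¹ * (Real.log x + Real.eulerMascheroniConstant - digamma (B - 1))

theorem besselPrimSq_isBigO_of_lt {B : ℝ} (hB : 5 < B) :
    (fun x => besselPrimSq B x - besselPrimSqLeading B x)
      =O[atTop] fun x => x ^ (-(B / 2 - 1 / 4)) := by
  have hB1 : 1 ≤ B := by linarith
  have h := (integral_Ioi_one_weight_mul_bessel_isBigO (w := Real.log) (r := 1) hB1
    -- The crude bound `log s ≤ s` suffices for the tail, at the price of requiring `B > 9 / 2`.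
    (by linarith) fun s hs => by
      rw [abs_of_nonneg (Real.log_nonneg hs), Real.rpow_one]
      exact Real.log_le_self (by linarith))
  refine h.congr' ?_ EventuallyEq.rfl
  filter_upwards [eventually_gt_atTop 0] with x hx
  obtain ⟨hil, hl⟩ := integral_log_mul_bessel (B := B) (by linarith)
  have hib : IntegrableOn (bessel B) (Ioi 0) := by
    simpa using integrableOn_rpow_mul_bessel hB1 one_pos (by linarith)
  have hb : ∫ t in Ioi (0 : ℝ), bessel B t = B - 1 := by
    have := integral_rpow_mul_bessel hB1 one_pos (by linarith) (by linarith)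
    rw [← besselPrimCoeff_one (by linarith), besselPrimCoeff, ← this]
    simp
  have hi : IntegrableOn (fun t => Real.log t * bessel B t - Real.log x * bessel B t) (Ioi 0) :=
    hil.sub (hib.const_mul _)
  have e : ∀ s ∈ Ioi (0 : ℝ), Real.log (x * s) * bessel B (x * s) - Real.log x * bessel B (x * s)
      = Real.log s * bessel B (x * s) := fun s hs => by
    rw [Real.log_mul hx.ne' (ne_of_gt hs)]; ring
  have hi1 : IntegrableOn (fun s => Real.log s * bessel B (x * s)) (Ioi 0) :=
    (integrableOn_congr_fun e measurableSet_Ioi).1 ((integrableOn_Ioi_comp_mul_left_iff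
      (fun t => Real.log t * bessel B t - Real.log x * bessel B t) 0 hx).2 (by simpa using hi))
  have h1 := integral_comp_mul_left_Ioi
    (fun t => Real.log t * bessel B t - Real.log x * bessel B t) 0 hx
  rw [setIntegral_congr_fun measurableSet_Ioi e, mul_zero, smul_eq_mul,
    integral_sub hil (hib.const_mul _), integral_const_mul, hl, hb,
    integral_Ioi_eq_Ioc_add_Ioi hi1, integral_log_mul_bessel_Ioc hB1] at h1
  rw [besselPrimSqLeading]
  linear_combination h1

/-- The leading term `1 / x` contributed by `besselPrim 1 (B + 1)` is absorbed by `ψ(B) = ψ(B - 1) +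
1 / (B - 1)`. -/
theorem besselPrimSq_isBigO_of_add_one {B : ℝ} (hB : 1 < B)
    (h : (fun x => besselPrimSq (B + 1) x - besselPrimSqLeading (B + 1) x)
      =O[atTop] fun x => x ^ (-(B / 2 + 1 / 4))) :
    (fun x => besselPrimSq B x - besselPrimSqLeading B x)
      =O[atTop] fun x => x ^ (-(B / 2 + 1 / 4)) := by
  have h1 := (besselPrim_isBigO (c := 1) (B := B + 1) (by linarith) one_pos).trans
    (rpow_isBigO_rpow_of_le (p := -((B + 1) / 2 + 1 / 4)) (q := -(B / 2 + 1 / 4)) (by linarith))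
  refine ((h1.const_mul_left (1 / B)).add (h.const_mul_left ((B - 1) / B))).congr_left fun x => ?_
  have h2 := digamma_add_one (x := B - 1) (by linarith)
  rw [sub_add_cancel] at h2
  have h3 : B - 1 ≠ 0 := by linarith
  have h4 : B ≠ 0 := by linarith
  rw [besselPrimSq_contiguous hB.le, besselPrimCoeff_one (by linarith), besselPrimSqLeading,
    besselPrimSqLeading, add_sub_cancel_right, h2, Real.rpow_neg_one]
  field_simp
  ring

/-- The asymptotic expansion of `∑ t_k / (1 + k) ^ 2`. -/
theorem besselPrimSq_isBigO {B : ℝ} (hB : 1 < B) :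
    (fun x => besselPrimSq B x - besselPrimSqLeading B x)
      =O[atTop] fun x => x ^ (-(B / 2 + 1 / 4)) := by
  obtain ⟨m, hm⟩ := exists_nat_gt (4 : ℝ)
  have hm' : 4 < B + m := by linarith
  clear hm
  induction m generalizing B with
  | zero =>
    refine besselPrimSq_isBigO_of_add_one hB ?_
    norm_num at hm'
    have h := besselPrimSq_isBigO_of_lt (B := B + 1) (by linarith)
    rwa [show (B + 1) / 2 - 1 / 4 = B / 2 + 1 / 4 by ring] at h
  | succ m ih =>
    refine besselPrimSq_isBigO_of_add_one hB ?_
    push_cast at hm'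
    exact (ih (B := B + 1) (by linarith) (by linarith)).trans
      (rpow_isBigO_rpow_of_le (by linarith))

/-! ### Reduction of the ₃F₄ series by partial fractions -/

theorem eval_ascPochhammer_div {c : ℝ} (hc : 0 < c) (k : ℕ) :
    (ascPochhammer ℝ k).eval c / (ascPochhammer ℝ k).eval (c + 1) = c / (c + k) := by
  have h := inv_eval_ascPochhammer hc k
  have h0 := ascPochhammer_pos k c hc
  have h1 := ascPochhammer_pos k (c + 1) (by linarith)
  have h2 : 0 < c + k := by positivity
  rw [inv_eq_one_div, div_eq_div_iff h0.ne' (by positivity)] at h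
  rw [div_eq_div_iff h1.ne' h2.ne']
  linarith

theorem hypergeometricTerm_eq {a b : ℝ} (ha : 0 < a) (x : ℝ) (k : ℕ) :
    hypergeometricTerm [1, 5 / 2, a] [2, 3 / 2, b + 1, a + 1] (-x) k
      = a / 3 * ((2 * k + 3) / ((1 + k) * (a + k))) * besselTerm (b + 1) x k := by
  have h1 := eval_ascPochhammer_div one_pos k
  have h2 := eval_ascPochhammer_div (c := 3 / 2) (by norm_num) k
  have h3 := eval_ascPochhammer_div ha k
  rw [one_add_one_eq_two] at h1
  rw [show (3 / 2 + 1 : ℝ) = 5 / 2 by norm_num, ← inv_inj, inv_div, inv_div] at h2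
  unfold hypergeometricTerm
  simp only [List.map_cons, List.map_nil, List.prod_cons, List.prod_nil, mul_one]
  calc _ = (ascPochhammer ℝ k).eval 1 / (ascPochhammer ℝ k).eval 2 *
        ((ascPochhammer ℝ k).eval (5 / 2) / (ascPochhammer ℝ k).eval (3 / 2)) *
        ((ascPochhammer ℝ k).eval a / (ascPochhammer ℝ k).eval (a + 1)) *
        besselTerm (b + 1) x k := by
          rw [besselTerm]
          ring
    _ = _ := by
          rw [h1, h2, h3]
          have : 0 < a + k := by positivity
          field_simp
          ring

theorem hypergeometric_eq_of_ne_one {a b : ℝ} (ha : 0 < a) (ha1 : a ≠ 1) (hb : 0 ≤ b) (x : ℝ) :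
    hypergeometric [1, 5 / 2, a] [2, 3 / 2, b + 1, a + 1] (-x)
      = a / (3 * (a - 1)) * (besselPrim 1 (b + 1) x + (2 * a - 3) * besselPrim a (b + 1) x) := by
  have hb1 : 1 ≤ b + 1 := by linarith
  rw [hypergeometric, besselPrim, besselPrim, ← tsum_mul_left,
    ← (summable_besselPrim one_pos hb1 x).tsum_add ((summable_besselPrim ha hb1 x).mul_left _),
    ← tsum_mul_left]
  refine tsum_congr fun k => ?_
  rw [hypergeometricTerm_eq ha]
  have h1 : a - 1 ≠ 0 := sub_ne_zero.2 ha1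
  have h2 : 0 < a + k := by positivity
  field_simp
  ring

theorem hypergeometric_eq_one {b : ℝ} (hb : 0 ≤ b) (x : ℝ) :
    hypergeometric [1, 5 / 2, 1] [2, 3 / 2, b + 1, 1 + 1] (-x)
      = 1 / 3 * (2 * besselPrim 1 (b + 1) x + besselPrimSq (b + 1) x) := by
  have hb1 : 1 ≤ b + 1 := by linarith
  rw [hypergeometric, besselPrim, besselPrimSq, ← tsum_mul_left,
    ← ((summable_besselPrim one_pos hb1 x).mul_left _).tsum_add (summable_besselPrimSq hb1 x),
    ← tsum_mul_left]
  refine tsum_congr fun k => ?_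
  rw [hypergeometricTerm_eq one_pos]
  field_simp
  ring

theorem hypergeometric_eq_zero (b x : ℝ) :
    hypergeometric [1, 5 / 2, 0] [2, 3 / 2, b + 1, 0 + 1] x = 1 := by
  rw [hypergeometric, tsum_eq_single 0]
  · simp [hypergeometricTerm]
  · intro k hk
    simp only [hypergeometricTerm, List.map_cons, List.prod_cons,
      ascPochhammer_ne_zero_eval_zero ℝ hk, zero_mul, mul_zero, zero_div]

/-! ### The error estimate for the multiplier -/

theorem tendsto_paramZ {n : ℕ} {δ : ℝ} (hδ : 0 < δ) :
    Tendsto (paramZ (n := n) δ) (cobounded (EuclideanSpace ℝ (Fin n))) atTop :=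
  (tendsto_norm_cobounded_atTop.const_mul_atTop hδ).atTop_div_const two_pos

theorem norm_sq_eq_paramZ {n : ℕ} {δ : ℝ} (hδ : 0 < δ) (ν : EuclideanSpace ℝ (Fin n)) :
    ‖ν‖ ^ 2 = 4 / δ ^ 2 * paramZ δ ν ^ 2 := by
  rw [paramZ]
  field_simp
  norm_num

/-- An error `O(x ^ (-((b + 1) / 2 + 1 / 4)))` in `x = z ^ 2` becomes, after multiplication by `x`,
the error `O(‖ν‖ ^ (-(n + 1) / 2))`. -/
theorem isBigO_comp_paramZ {n : ℕ} {δ : ℝ} (hδ : 0 < δ) {R : ℝ → ℝ}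
    (hR : R =O[atTop] fun x => x ^ (-((paramB n + 1) / 2 + 1 / 4))) :
    (fun ν : EuclideanSpace ℝ (Fin n) => paramZ δ ν ^ 2 * R (paramZ δ ν ^ 2))
      =O[cobounded (EuclideanSpace ℝ (Fin n))] fun ν => ‖ν‖ ^ (-((n : ℝ) + 1) / 2) := by
  have hz := tendsto_paramZ (n := n) hδ
  have h1 := hR.comp_tendsto ((tendsto_pow_atTop two_ne_zero).comp hz)
  refine ((isBigO_refl (fun ν : EuclideanSpace ℝ (Fin n) => paramZ δ ν ^ 2) _).mul h1).trans ?_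
  refine IsBigO.of_bound ((δ / 2) ^ (-((n : ℝ) + 1) / 2)) ?_
  filter_upwards [hz.eventually_gt_atTop 0] with ν hν
  simp only [Function.comp_apply]
  have e : paramZ δ ν ^ 2 * (paramZ δ ν ^ 2) ^ (-((paramB n + 1) / 2 + 1 / 4))
      = (δ / 2) ^ (-((n : ℝ) + 1) / 2) * ‖ν‖ ^ (-((n : ℝ) + 1) / 2) := by
    rw [← Real.mul_rpow (by positivity) (norm_nonneg _), ← Real.rpow_natCast, ← Real.rpow_mul hν.le,
      ← Real.rpow_add hν, paramZ, paramB]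
    congr 1
    · ring
    · push_cast; ring
  rw [e, norm_mul, Real.norm_of_nonneg (r := (δ / 2) ^ _) (by positivity)]

/-- The asymptotic value of `λ₁,₁`. -/
def lambda11Asymptotic {n : ℕ} (δ β μ : ℝ) (ν : EuclideanSpace ℝ (Fin n)) : ℝ :=
  if β = n then
    -(4 * μ * paramA n β * paramB n / δ ^ 2) *
      (2 * Real.log (paramZ δ ν) + Real.eulerMascheroniConstant + 2 - digamma (paramB n))
  else
    -(4 * μ * paramA n β * paramB n / (δ ^ 2 * (paramA n β - 1))) -
      (n - β - 1) / (n - β) * (Real.Gamma (paramB n + 1) * Real.Gamma (paramA n β + 1) /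
        Real.Gamma ((β + 2) / 2)) * (8 * μ / δ ^ 2) * paramZ δ ν ^ (β - n)

theorem lambda11_sub_isBigO_of_ne {n : ℕ} {δ β : ℝ} (μ : ℝ) (hδ : 0 < δ) (hβ : β < n + 2)
    (hne : β ≠ n) :
    (fun ν : EuclideanSpace ℝ (Fin n) => lambda11 δ β μ ν - lambda11Asymptotic δ β μ ν)
      =O[cobounded (EuclideanSpace ℝ (Fin n))] fun ν => ‖ν‖ ^ (-((n : ℝ) + 1) / 2) := by
  set a := paramA n β with ha
  set b := paramB n with hb
  have ha' : a = ((n : ℝ) + 2 - β) / 2 := rfl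
  have hb' : b = ((n : ℝ) + 2) / 2 := rfl
  have hn : (0 : ℝ) ≤ n := n.cast_nonneg
  have ha0 : 0 < a := by rw [ha']; linarith
  have hb1 : 1 ≤ b := by rw [hb']; linarith
  have hne' : (n : ℝ) - β ≠ 0 := sub_ne_zero.2 hne.symm
  have ha1 : a - 1 = (n - β) / 2 := by rw [ha']; ring
  have ha1' : a - 1 ≠ 0 := by rw [ha1]; exact div_ne_zero hne' two_ne_zero
  have h1 := besselPrim_isBigO (B := b + 1) (by linarith) one_pos
  have h2 := besselPrim_isBigO (B := b + 1) (by linarith) ha0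
  have h3 := isBigO_comp_paramZ hδ ((h1.add (h2.const_mul_left (2 * a - 3))).const_mul_left
    (-(4 * μ * a / (δ ^ 2 * (a - 1)))))
  refine h3.congr' ?_ EventuallyEq.rfl
  filter_upwards [(tendsto_paramZ hδ).eventually_gt_atTop 0] with ν hν
  set z := paramZ δ ν
  have e1 : (z ^ 2) ^ (-(1 : ℝ)) = (z ^ 2)⁻¹ := Real.rpow_neg_one _
  have e2 : (z ^ 2) ^ (-a) = (z ^ 2)⁻¹ * z ^ (β - n) := by
    rw [← Real.rpow_natCast, ← Real.rpow_neg hν.le, ← Real.rpow_mul hν.le, ← Real.rpow_add hν, ha']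
    congr 1
    push_cast; ring
  have e3 : besselPrimCoeff a (b + 1)
      = Real.Gamma a * Real.Gamma (b + 1) / Real.Gamma ((β + 2) / 2) := by
    rw [besselPrimCoeff, ha', hb']
    ring_nf
  rw [lambda11, lambda11Asymptotic, if_neg hne, ← ha, ← hb, norm_sq_eq_paramZ hδ,
    hypergeometric_eq_of_ne_one ha0 (sub_ne_zero.1 ha1') (by linarith),
    besselPrimCoeff_one (by linarith), e1, e2, e3, Real.Gamma_add_one ha0.ne']
  have e4 : ((n : ℝ) - β - 1) / (n - β) = (2 * a - 3) / (2 * (a - 1)) := by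
    rw [ha']
    rw [div_eq_div_iff hne' (by rw [← ha', ha1]; simpa using hne')]
    ring
  rw [e4]
  -- This value is 0 at the poles, so it cannot be cleared as a denominator; it is carried along as
  -- an opaque inverse.
  generalize (Real.Gamma ((β + 2) / 2)) = g
  simp only [div_eq_mul_inv _ g]
  have hz0 := hν.ne'
  change _ = -3 * μ * (4 / δ ^ 2 * z ^ 2) * _ - _
  field_simp
  ring

theorem lambda11_sub_isBigO_of_eq {n : ℕ} {δ : ℝ} (μ : ℝ) (hδ : 0 < δ) :
    (fun ν : EuclideanSpace ℝ (Fin n) => lambda11 δ n μ ν - lambda11Asymptotic δ n μ ν)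
      =O[cobounded (EuclideanSpace ℝ (Fin n))] fun ν => ‖ν‖ ^ (-((n : ℝ) + 1) / 2) := by
  have ha : paramA n n = 1 := by rw [paramA]; ring
  have hn : (0 : ℝ) ≤ n := n.cast_nonneg
  have hb1 : 1 ≤ paramB n := by rw [paramB]; linarith
  have h1 := besselPrim_isBigO (B := paramB n + 1) (by linarith) one_pos
  have h2 := besselPrimSq_isBigO (B := paramB n + 1) (by linarith)
  have h3 := isBigO_comp_paramZ hδ (((h1.const_mul_left 2).add h2).const_mul_left
    (-(4 * μ / δ ^ 2)))
  refine h3.congr' ?_ EventuallyEq.rfl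
  filter_upwards [(tendsto_paramZ hδ).eventually_gt_atTop 0] with ν hν
  have hz0 := hν.ne'
  rw [lambda11, lambda11Asymptotic, if_pos rfl, norm_sq_eq_paramZ hδ, ha,
    hypergeometric_eq_one (by linarith), besselPrimCoeff_one (by linarith), besselPrimSqLeading,
    add_sub_cancel_right, Real.rpow_neg_one, Real.log_pow]
  push_cast
  field_simp
  ring

/-- Here `a = 0`: the series is 1, the constant in `A` vanishes, and the power term is exactly `-3 μ
‖ν‖²`. -/
theorem lambda11_eq_of_eq_add_two {n : ℕ} {δ : ℝ} (μ : ℝ) (hδ : 0 < δ)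
    (ν : EuclideanSpace ℝ (Fin n)) :
    lambda11 δ (n + 2) μ ν = lambda11Asymptotic δ (n + 2) μ ν := by
  have ha : paramA n (n + 2) = 0 := by rw [paramA]; ring
  have hb : ((n : ℝ) + 2 + 2) / 2 = paramB n + 1 := by rw [paramB]; ring
  have hb0 : 0 < paramB n + 1 := by rw [paramB]; positivity
  rw [lambda11, lambda11Asymptotic, if_neg (by simp), ha, hypergeometric_eq_zero, hb,
    norm_sq_eq_paramZ hδ, zero_add, Real.Gamma_one, mul_one (Real.Gamma _),
    div_self (Real.Gamma_pos_of_pos hb0).ne', show (n : ℝ) + 2 - n = (2 : ℕ) by push_cast; ring,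
    Real.rpow_natCast, show ((n : ℝ) - (n + 2) - 1) / (n - (n + 2)) = 3 / 2 by
      rw [show (n : ℝ) - (n + 2) - 1 = -3 by ring, show (n : ℝ) - (n + 2) = -2 by ring]; norm_num]
  ring

theorem lambda11_sub_isBigO {n : ℕ} {δ β : ℝ} (μ : ℝ) (hδ : 0 < δ) (hβ : β ≤ n + 2) :
    (fun ν : EuclideanSpace ℝ (Fin n) => lambda11 δ β μ ν - lambda11Asymptotic δ β μ ν)
      =O[cobounded (EuclideanSpace ℝ (Fin n))] fun ν => ‖ν‖ ^ (-((n : ℝ) + 1) / 2) := by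
  rcases hβ.eq_or_lt with rfl | hlt
  · simp only [lambda11_eq_of_eq_add_two μ hδ, sub_self]
    exact isBigO_zero _ _
  · by_cases h : β = n
    · subst h
      exact lambda11_sub_isBigO_of_eq μ hδ
    · exact lambda11_sub_isBigO_of_ne μ hδ hlt h

/-! ### Lower bound for the asymptotic value, and equivalence -/

theorem eventually_one_le_abs_add_mul (p : ℝ) {q : ℝ} (hq : q ≠ 0) :
    ∀ᶠ t : ℝ in atTop, 1 ≤ |p + q * t| := by
  have hq' : 0 < |q| := abs_pos.2 hq
  filter_upwards [eventually_ge_atTop ((1 + |p|) / |q|), eventually_ge_atTop 0] with t ht ht0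
  rw [div_le_iff₀ hq'] at ht
  have h1 := abs_sub_abs_le_abs_sub (q * t) (-p)
  rw [abs_neg, abs_mul, abs_of_nonneg ht0, sub_neg_eq_add, add_comm (q * t)] at h1
  linarith

/-- `A` tends to a nonzero constant for `β < n`, and grows like `log z` for `β = n` or `z^(β-n)` for
`β > n`. In the last case the coefficient is nonzero since all Gamma arguments are positive and `n -
β - 1 < 0`. -/
theorem one_isBigO_lambda11Asymptotic {n : ℕ} {δ β μ : ℝ} (hδ : 0 < δ) (hβ : β ≤ n + 2)
    (hμ : μ ≠ 0) :
    (fun _ : EuclideanSpace ℝ (Fin n) => (1 : ℝ))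
      =O[cobounded (EuclideanSpace ℝ (Fin n))] lambda11Asymptotic δ β μ := by
  suffices h : ∃ ε : ℝ, 0 < ε ∧ ∀ᶠ ν in cobounded (EuclideanSpace ℝ (Fin n)),
      ε ≤ |lambda11Asymptotic δ β μ ν| by
    obtain ⟨ε, hε, h⟩ := h
    refine IsBigO.of_bound ε⁻¹ ?_
    filter_upwards [h] with ν hν
    rw [norm_one, Real.norm_eq_abs, ← div_eq_inv_mul, one_le_div hε]
    exact hν
  have hz := tendsto_paramZ (n := n) hδ
  have hn : (0 : ℝ) ≤ n := n.cast_nonneg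
  have hb : 0 < paramB n := by rw [paramB]; positivity
  have hδ2 : δ ^ 2 ≠ 0 := by positivity
  rcases lt_trichotomy β n with hlt | rfl | hgt
  · have ha1 : 0 < paramA n β - 1 := by rw [paramA]; linarith
    have ha : 0 < paramA n β := by linarith
    set p := -(4 * μ * paramA n β * paramB n / (δ ^ 2 * (paramA n β - 1))) with hp
    have hp0 : p ≠ 0 := neg_ne_zero.2 (by positivity)
    have hpow : Tendsto (fun ν : EuclideanSpace ℝ (Fin n) => paramZ δ ν ^ (β - n))
        (cobounded (EuclideanSpace ℝ (Fin n))) (𝓝 0) := by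
      have := (tendsto_rpow_neg_atTop (y := n - β) (by linarith)).comp hz
      simpa [Function.comp_def] using this
    have hlim : Tendsto (lambda11Asymptotic δ β μ) (cobounded (EuclideanSpace ℝ (Fin n)))
        (𝓝 p) := by
      have h1 := (hpow.const_mul ((n - β - 1) / (n - β) * (Real.Gamma (paramB n + 1) *
        Real.Gamma (paramA n β + 1) / Real.Gamma ((β + 2) / 2)) * (8 * μ / δ ^ 2))).const_sub p
      rw [mul_zero, sub_zero] at h1
      refine h1.congr fun ν => ?_
      rw [lambda11Asymptotic, if_neg hlt.ne]
    refine ⟨|p| / 2, half_pos (abs_pos.2 hp0), ?_⟩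
    exact hlim.abs.eventually_const_le (half_lt_self (abs_pos.2 hp0))
  · refine ⟨1, one_pos, ?_⟩
    have ha : paramA n n = 1 := by rw [paramA]; ring
    have hq : -(8 * μ * paramB n / δ ^ 2) ≠ 0 := neg_ne_zero.2 (by positivity)
    filter_upwards [(Real.tendsto_log_atTop.comp hz).eventually (eventually_one_le_abs_add_mul
      (-(4 * μ * paramB n / δ ^ 2) *
        (Real.eulerMascheroniConstant + 2 - digamma (paramB n))) hq)] with ν hν
    rw [lambda11Asymptotic, if_pos rfl, ha]
    refine hν.trans_eq (congrArg abs ?_)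
    simp only [Function.comp_apply]
    ring
  · refine ⟨1, one_pos, ?_⟩
    have ha : 0 ≤ paramA n β := by rw [paramA]; linarith
    have hG1 := Real.Gamma_pos_of_pos (s := paramB n + 1) (by linarith)
    have hG2 := Real.Gamma_pos_of_pos (s := paramA n β + 1) (by linarith)
    have hG3 := Real.Gamma_pos_of_pos (s := (β + 2) / 2) (by linarith)
    have h1 : (n : ℝ) - β - 1 ≠ 0 := by linarith
    have h2 : (n : ℝ) - β ≠ 0 := by linarith
    have hq : -((n - β - 1) / (n - β) * (Real.Gamma (paramB n + 1) *
        Real.Gamma (paramA n β + 1) / Real.Gamma ((β + 2) / 2)) * (8 * μ / δ ^ 2)) ≠ 0 :=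
      neg_ne_zero.2 (by positivity)
    filter_upwards [((tendsto_rpow_atTop (y := β - n) (by linarith)).comp hz).eventually
      (eventually_one_le_abs_add_mul
      (-(4 * μ * paramA n β * paramB n / (δ ^ 2 * (paramA n β - 1)))) hq)] with ν hν
    rw [lambda11Asymptotic, if_neg hgt.ne']
    refine hν.trans_eq (congrArg abs ?_)
    simp only [Function.comp_apply]
    ring

theorem lambda11_isEquivalent {n : ℕ} {δ β : ℝ} (μ : ℝ) (hδ : 0 < δ) (hβ : β ≤ n + 2) :
    IsEquivalent (cobounded (EuclideanSpace ℝ (Fin n))) (lambda11 δ β μ)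
      (lambda11Asymptotic δ β μ) := by
  -- If `μ = 0` then `A` vanishes identically and the lower bound fails, but so does `lambda11`.
  by_cases hμ : μ = 0
  · have h : lambda11 (n := n) δ β μ = lambda11Asymptotic δ β μ := by
      funext ν
      simp [lambda11, lambda11Asymptotic, hμ]
    rw [h]
  · have h1 : (fun ν : EuclideanSpace ℝ (Fin n) => ‖ν‖ ^ (-((n : ℝ) + 1) / 2))
        =o[cobounded (EuclideanSpace ℝ (Fin n))] fun _ => (1 : ℝ) := by
      rw [isLittleO_one_iff]
      have hn : (0 : ℝ) < ((n : ℝ) + 1) / 2 := by positivity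
      have := (tendsto_rpow_neg_atTop hn).comp
        (tendsto_norm_cobounded_atTop (E := EuclideanSpace ℝ (Fin n)))
      simpa only [Function.comp_def, neg_div] using this
    exact (lambda11_sub_isBigO μ hδ hβ).trans_isLittleO
      (h1.trans_isBigO (one_isBigO_lambda11Asymptotic hδ hβ hμ))

end

end Peridynamics

/-- As `‖ν‖ → ∞`, `λ₁,₁(ν)` is asymptotically equivalent to the displayed expression `A ν`, and
the error `λ₁,₁(ν) - A ν` is `O(‖ν‖ ^ (-(n + 1) / 2))`, so that the lower order terms of `A` also
carry information. -/
theorem mainTheorem3 (n : ℕ) (hn : 1 ≤ n) (δ β μ : ℝ) (hδ : 0 < δ) (hβ : β ≤ n + 2) :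
    let a : ℝ := Peridynamics.paramA n β
    let b : ℝ := Peridynamics.paramB n
    let z : EuclideanSpace ℝ (Fin n) → ℝ := Peridynamics.paramZ δ
    let A : EuclideanSpace ℝ (Fin n) → ℝ := fun ν =>
      if β = n then
        -(4 * μ * a * b / δ ^ 2) *
          (2 * Real.log (z ν) + Real.eulerMascheroniConstant + 2 - Peridynamics.digamma b)
      else
        -(4 * μ * a * b / (δ ^ 2 * (a - 1))) -
          (n - β - 1) / (n - β) * (Real.Gamma (b + 1) * Real.Gamma (a + 1) /
            Real.Gamma ((β + 2) / 2)) * (8 * μ / δ ^ 2) * z ν ^ (β - n)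
    IsEquivalent (cobounded (EuclideanSpace ℝ (Fin n))) (Peridynamics.lambda11 δ β μ) A ∧
    IsBigO (cobounded (EuclideanSpace ℝ (Fin n)))
      (fun ν => Peridynamics.lambda11 δ β μ ν - A ν)
      (fun ν => ‖ν‖ ^ (-((n : ℝ) + 1) / 2)) :=
  ⟨Peridynamics.lambda11_isEquivalent μ hδ hβ, Peridynamics.lambda11_sub_isBigO μ hδ hβ⟩
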